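/- Let $n\ge 1$ and let $\mathbb{H}^n=\mathbb{R}^{2n}\times\mathbb{R}$ be the Heisenberg group, with points $x=(x_H,x_T)$, product $x*y=(x_H+y_H,\;x_T+y_T+2\langle x_H,Jy_H\rangle)$, where $J=\begin{pmatrix}0&\mathrm{id}\\-\mathrm{id}&0\end{pmatrix}$, dilations $D_r(x)=(rx_H,r^2x_T)$, and the Koranyi distance $$d(x,y)=\bigl(|y_H-x_H|^4+|y_T-x_T-2\langle x_H,Jy_H\rangle|^2\bigr)^{1/4},\qquad B_r(x)=\{z: d(z,x)\le r\}.$$ For an integer $m\ge1$, a Radon measure $\mu$ on $\mathbb{H}^n$ is called $m$-uniform if $0\in\operatorname{supp}(\mu)$ and $\mu(B_r(x))=r^m$ for all $x\in\operatorname{supp}(\mu)$ and $r>0$. For $r>0$ let $\mu_{0,r}(A)=\mu(D_r(A))$ for Borel sets $A$. Denote by $\mathrm{Tan}_m(\mu,\infty)$ the set of Radon measures $\nu$ for which there is a sequence $R_i\to\infty$ with $R_i^{-m}\mu_{0,R_i}\rightharpoonup\nu$, where $\rightharpoonup$ is convergence tested against continuous compactly supported functions. An $m$-uniform measure $\nu$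 is called an $m$-uniform cone if $\lambda^{-m}\nu_{0,\lambda}=\nu$ for every $\lambda>0$. **Theorem.** Let $\mu$ be a $(2n+1)$-uniform measure on $\mathbb{H}^n$. Then $\mathrm{Tan}_{2n+1}(\mu,\infty)$ is a singleton $\{\nu\}$, and its element $\nu$ is a $(2n+1)$-uniform cone. -/

import Mathlib

open MeasureTheory Filter Topology

noncomputable section

/-- The underlying manifold `ℝ²ⁿ × ℝ` of the Heisenberg group `ℍⁿ`, with its Euclidean topology
and Borel σ-algebra.  The horizontal part `x.1` is a vector of `ℝ²ⁿ` with the Euclidean norm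
(coordinates indexed by two blocks of size `n`), and `x.2` is the last coordinate. -/
abbrev Heis (n : ℕ) : Type := EuclideanSpace ℝ (Fin n ⊕ Fin n) × ℝ

namespace Heis

variable {n : ℕ}

/-- The standard symplectic matrix, with blocks `0, id; -id, 0`. -/
def J (n : ℕ) : Matrix (Fin n ⊕ Fin n) (Fin n ⊕ Fin n) ℝ :=
  Matrix.fromBlocks 0 1 (-1) 0

/-- The bilinear form `⟨u, J v⟩` on `ℝ²ⁿ`. -/
def symp (u v : EuclideanSpace ℝ (Fin n ⊕ Fin n)) : ℝ :=
  inner ℝ u (WithLp.toLp 2 (Matrix.mulVec (J n) v.ofLp))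

/-- The group law `x * y = (x_H + y_H, x_T + y_T + 2⟨x_H, J y_H⟩)`. -/
def mul (x y : Heis n) : Heis n :=
  (x.1 + y.1, x.2 + y.2 + 2 * symp x.1 y.1)

/-- The group inverse. -/
def inv (x : Heis n) : Heis n := (-x.1, -x.2)

/-- The anisotropic dilation `D_r x = (r x_H, r² x_T)`. -/
def dil (r : ℝ) (x : Heis n) : Heis n := (r • x.1, r ^ 2 * x.2)

/-- The Koranyi distance. -/
def dist (x y : Heis n) : ℝ :=
  (‖y.1 - x.1‖ ^ 4 + |y.2 - x.2 - 2 * symp x.1 y.1| ^ 2) ^ (1 / 4 : ℝ)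

/-- The Koranyi ball of centre `x` and radius `r`. -/
def ball (x : Heis n) (r : ℝ) : Set (Heis n) := {z | dist z x ≤ r}

/-- Radon measures on `ℍⁿ`: Borel measures that are finite on compact sets, outer regular, and
inner regular on open sets with respect to compact sets. -/
def IsRadon (μ : Measure (Heis n)) : Prop := μ.Regular

/-- The translated and dilated measure `μ_{x,r}`, defined for `r > 0` by
`μ_{x,r}(A) = μ(x * D_r(A))`, i.e. the image of `μ` under `y ↦ D_{1/r}(x⁻¹ * y)`. -/
def rescale (μ : Measure (Heis n)) (x : Heis n) (r : ℝ) : Measure (Heis n) :=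
  μ.map fun y => dil r⁻¹ (mul (inv x) y)

/-- The normalised measure `r^{-m} μ_{x,r}`. -/
def blowup (m : ℕ) (μ : Measure (Heis n)) (x : Heis n) (r : ℝ) : Measure (Heis n) :=
  ENNReal.ofReal ((r ^ m)⁻¹) • rescale μ x r

/-- Weak convergence `μ_k ⇀ μ`, tested on continuous compactly supported functions. -/
def WeakConv (μs : ℕ → Measure (Heis n)) (μ : Measure (Heis n)) : Prop :=
  ∀ f : Heis n → ℝ, Continuous f → HasCompactSupport f →
    Tendsto (fun k => ∫ z, f z ∂(μs k)) atTop (𝓝 (∫ z, f z ∂μ))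

/-- `m`-uniform measures on `ℍⁿ`. -/
structure IsUniform (m : ℕ) (μ : Measure (Heis n)) : Prop where
  radon : IsRadon μ
  zero_mem : (0 : Heis n) ∈ μ.support
  measure_ball : ∀ x ∈ μ.support, ∀ r : ℝ, 0 < r → μ (ball x r) = ENNReal.ofReal (r ^ m)

/-- The set of `m`-dimensional tangent measures at infinity of `μ`. -/
def tanInfty (m : ℕ) (μ : Measure (Heis n)) : Set (Measure (Heis n)) :=
  {ν | IsRadon ν ∧ ∃ R : ℕ → ℝ, (∀ i, 0 < R i) ∧ Tendsto R atTop atTop ∧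
    WeakConv (fun i => blowup m μ 0 (R i)) ν}

/-- `m`-uniform cones: the `m`-uniform measures with `r^{-m} μ_{0,r} = μ` for all `r > 0`. -/
structure IsUniformCone (m : ℕ) (μ : Measure (Heis n)) : Prop where
  isUniform : IsUniform m μ
  blowup_eq : ∀ r : ℝ, 0 < r → blowup m μ 0 r = μ

lemma symp_apply (u v : EuclideanSpace ℝ (Fin n ⊕ Fin n)) :
    symp u v = ∑ i : Fin n, (u (Sum.inl i) * v (Sum.inr i) - u (Sum.inr i) * v (Sum.inl i)) := by
  simp [symp, J, PiLp.inner_apply, Matrix.mulVec, dotProduct, Matrix.one_apply,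
    Finset.sum_add_distrib, mul_comm, sub_eq_add_neg]

lemma mul_assoc' (x y z : Heis n) : mul (mul x y) z = mul x (mul y z) := by
  ext
  · simp [mul, add_assoc]
  · simp only [mul, symp_apply, PiLp.add_apply, Finset.mul_sum]
    have : ∀ a b c d e f g : ℝ, d + e = f + g → a + b + d + c + e = a + (b + c + f) + g := by
      intros; linarith
    apply this
    rw [← Finset.sum_add_distrib, ← Finset.sum_add_distrib]
    exact Finset.sum_congr rfl fun i _ => by ring

lemma dist_eq (x y : Heis n) : dist x y = dist 0 (mul (inv x) y) := by
  have h0 : ∀ v, symp (0 : EuclideanSpace ℝ (Fin n ⊕ Fin n)) v = 0 := by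
    intro v; simp [symp]
  have h1 : symp (-x.1) y.1 = - symp x.1 y.1 := by simp [symp]
  simp only [dist, mul, inv, Prod.fst_zero, Prod.snd_zero, h0, h1]
  congr 3
  · congr 1; abel
  · congr 1; ring

lemma inv_mul_cancel' (x y : Heis n) : mul (inv x) (mul x y) = y := by
  rw [← mul_assoc']
  ext <;> simp [mul, inv, symp_apply]
  exact Finset.sum_eq_zero fun i _ => by ring

lemma mul_inv_cancel' (x y : Heis n) : mul x (mul (inv x) y) = y := by
  rw [← mul_assoc']
  ext <;> simp [mul, inv, symp_apply]
  exact Finset.sum_eq_zero fun i _ => by ring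

lemma dil_inv_dil {r : ℝ} (hr : r ≠ 0) (x : Heis n) : dil r⁻¹ (dil r x) = x := by
  ext <;> simp [dil, hr]

lemma rescale_apply (μ : Measure (Heis n)) (x : Heis n) {r : ℝ} (hr : 0 < r)
    {A : Set (Heis n)} (hA : MeasurableSet A) :
    rescale μ x r A = μ ((fun y => mul x (dil r y)) '' A) := by
  have hc : Continuous fun y : Heis n => dil r⁻¹ (mul (inv x) y) := by
    simp only [dil, mul, symp_apply]; fun_prop
  rw [rescale, Measure.map_apply hc.measurable hA]
  congr 1
  ext y
  constructor
  · intro hy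
    refine ⟨_, hy, ?_⟩
    have := dil_inv_dil (inv_ne_zero hr.ne') (mul (inv x) y)
    rw [inv_inv] at this
    simp only [this, mul_inv_cancel']
  · rintro ⟨z, hz, rfl⟩
    simpa [inv_mul_cancel', dil_inv_dil hr.ne'] using hz

end Heis

end

/-!
The tangent measure at infinity of an `m`-uniform measure `μ` on `ℍⁿ` is unique, for every `m`, by
a moment argument which uses no rectifiability and no positivity of the kernel.

Let `S` be the support of `μ`, let `ν_r = r^{-m} μ_{0,r}`, and let `k_s(x,z) = exp (-s d(x,z)⁴)`.
Since `d⁴` is a polynomial, `k_s(x,z) = k_s(0,z) ∑ⱼ aⱼ(x,z)` where `aⱼ` is polynomial in `x` and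
homogeneous of degree `j` for the dilations (`hasSum_kcoef`). By uniformity `∫ k_s(x,z) dν_r(z)`
is a constant `c_s` for all `x` in the rescaled support `D_{1/r} S`; hence, for `x ∈ S`, the sum
`∑_{1 ≤ j ≤ k} r^{-j} ∫ k_s(0,z) aⱼ(x,z) dν_r(z)` is `O(r^{-(k+1)})` (`exists_abs_taylor_le`).

Let `y` be a support point of some tangent measure at infinity `ν'`. The leading form at `y` of any
polynomial vanishing on `S` is zero, so by finite-dimensionality the leading form at `y` of a
polynomial of degree `k` is a fixed linear combination of values of the polynomial at finitely many
points of `S` (`exists_leading_form_eq`). Applied to the sums above, this gives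
`∫ k_s(0,z) a_k(y,z) dν_r(z) → 0` as `r → ∞`, for every `k ≥ 1` (`tendsto_integral_kcoef`). Thus
for *every* tangent measure at infinity `ν` all these integrals vanish, and summing the series,
`∫ k_s(y,z) dν(z) = c_s` for all `s > 0` and all `y ∈ supp ν'` (`IsBlowdown.lintegral_kernel_eq`).

As `k_s / c_s` is an approximate identity when `s → ∞`, Fatou's lemma and Tonelli's theorem give,
for `U` open, `ν'(U) ≤ liminf ∫_U ∫_U k_s / c_s dν dν' ≤ ν(U)`, and `ν = ν'` by symmetry
(`IsBlowdown.unique`). Everything is done for limits along arbitrary filters `l ≤ atTop`. Limits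
along ultrafilters exist by the Riesz representation theorem, so uniqueness implies that `ν_r`
converges as `r → ∞`; and the limit is a cone since rescaling it gives a limit again.
-/

open scoped ENNReal CompactlySupported

noncomputable section

namespace Heis

variable {n : ℕ}

/-! ### The Koranyi distance -/

/-- The fourth power of the Koranyi distance, a polynomial in both points. -/
def dist4 (x y : Heis n) : ℝ :=
  ‖y.1 - x.1‖ ^ 4 + (y.2 - x.2 - 2 * symp x.1 y.1) ^ 2

lemma dist4_nonneg (x y : Heis n) : 0 ≤ dist4 x y := by unfold dist4; positivity

lemma dist_eq_rpow (x y : Heis n) : dist x y = dist4 x y ^ (1 / 4 : ℝ) := by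
  rw [dist, dist4, sq_abs]

lemma dist_nonneg (x y : Heis n) : 0 ≤ dist x y := by
  rw [dist_eq_rpow]; exact Real.rpow_nonneg (dist4_nonneg x y) _

lemma dist_pow_four (x y : Heis n) : dist x y ^ 4 = dist4 x y := by
  rw [dist_eq_rpow, ← Real.rpow_natCast, ← Real.rpow_mul (dist4_nonneg x y)]
  norm_num

lemma dist_le_iff {x y : Heis n} {t : ℝ} (ht : 0 ≤ t) : dist x y ≤ t ↔ dist4 x y ≤ t ^ 4 := by
  rw [← dist_pow_four]
  exact (pow_le_pow_iff_left₀ (dist_nonneg x y) ht (by norm_num)).symm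

lemma symp_neg_swap (u v : EuclideanSpace ℝ (Fin n ⊕ Fin n)) : symp u v = -symp v u := by
  rw [symp_apply, symp_apply, ← Finset.sum_neg_distrib]
  exact Finset.sum_congr rfl fun i _ => by ring

lemma symp_self (u : EuclideanSpace ℝ (Fin n ⊕ Fin n)) : symp u u = 0 := by
  have := symp_neg_swap u u
  linarith

lemma symp_sub_left (u v w : EuclideanSpace ℝ (Fin n ⊕ Fin n)) :
    symp (u - v) w = symp u w - symp v w := by
  simp [symp, inner_sub_left]

lemma symp_sub_right (u v w : EuclideanSpace ℝ (Fin n ⊕ Fin n)) :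
    symp u (v - w) = symp u v - symp u w := by
  rw [symp_neg_swap, symp_sub_left, symp_neg_swap v, symp_neg_swap w]; ring

lemma symp_smul_left (r : ℝ) (u v : EuclideanSpace ℝ (Fin n ⊕ Fin n)) :
    symp (r • u) v = r * symp u v := by
  simp [symp, inner_smul_left]

lemma symp_smul_right (r : ℝ) (u v : EuclideanSpace ℝ (Fin n ⊕ Fin n)) :
    symp u (r • v) = r * symp u v := by
  rw [symp_neg_swap, symp_smul_left, symp_neg_swap v]; ring

@[simp] lemma symp_zero_left (v : EuclideanSpace ℝ (Fin n ⊕ Fin n)) : symp 0 v = 0 := by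
  simp [symp]

@[simp] lemma symp_zero_right (v : EuclideanSpace ℝ (Fin n ⊕ Fin n)) : symp v 0 = 0 := by
  rw [symp_neg_swap]; simp

/-- The Cauchy–Schwarz inequality for the Hermitian form whose real part is the scalar product and
whose imaginary part is the symplectic form. -/
lemma inner_sq_add_symp_sq_le (u v : EuclideanSpace ℝ (Fin n ⊕ Fin n)) :
    inner ℝ u v ^ 2 + symp u v ^ 2 ≤ ‖u‖ ^ 2 * ‖v‖ ^ 2 := by
  set w : EuclideanSpace ℝ (Fin n ⊕ Fin n) := WithLp.toLp 2 (Matrix.mulVec (J n) v.ofLp) with hw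
  have h1 : inner ℝ v w = 0 := symp_self v
  have h2 : ‖w‖ ^ 2 = ‖v‖ ^ 2 := by
    rw [EuclideanSpace.norm_sq_eq, EuclideanSpace.norm_sq_eq]
    simp only [hw, Fintype.sum_sum_type]
    simp [J, Matrix.mulVec, dotProduct, Matrix.one_apply, add_comm]
  have h3 : symp u v = inner ℝ u w := rfl
  rcases eq_or_ne v 0 with rfl | hv
  · simp
  have hv' : 0 < ‖v‖ ^ 2 := by positivity
  -- The defect in the inequality is the squared distance of `u` to the span of `v` and `J v`.
  have key : 0 ≤ ‖(‖v‖ ^ 2) • u - (inner ℝ u v : ℝ) • v - (inner ℝ u w : ℝ) • w‖ ^ 2 := by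
    positivity
  rw [← real_inner_self_eq_norm_sq] at key
  simp only [inner_sub_left, inner_sub_right, inner_smul_left, inner_smul_right,
    real_inner_self_eq_norm_sq, h1, h2, real_inner_comm u v, real_inner_comm u w,
    real_inner_comm v w, RCLike.conj_to_real] at key
  rw [h3]
  have : 0 ≤ ‖v‖ ^ 2 * (‖u‖ ^ 2 * ‖v‖ ^ 2 - (inner ℝ u v ^ 2 + inner ℝ u w ^ 2)) := by
    simp only [real_inner_comm v u, real_inner_comm w u] at key ⊢
    nlinarith [key]
  linarith [nonneg_of_mul_nonneg_right this hv']

lemma abs_symp_le (u v : EuclideanSpace ℝ (Fin n ⊕ Fin n)) : |symp u v| ≤ ‖u‖ * ‖v‖ := by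
  apply abs_le_of_sq_le_sq _ (by positivity)
  nlinarith [inner_sq_add_symp_sq_le u v, sq_nonneg (inner ℝ u v : ℝ)]

lemma dist_comm (x y : Heis n) : dist x y = dist y x := by
  rw [dist_eq_rpow, dist_eq_rpow, dist4, dist4, norm_sub_rev, symp_neg_swap]
  congr 2; ring

lemma dist4_comm (x y : Heis n) : dist4 x y = dist4 y x := by
  rw [← dist_pow_four, dist_comm, dist_pow_four]

@[simp] lemma dist_self (x : Heis n) : dist x x = 0 := by
  simp [dist_eq_rpow, dist4, symp_self]

lemma norm_fst_sub_le_dist (x y : Heis n) : ‖y.1 - x.1‖ ≤ dist x y := by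
  refine le_of_pow_le_pow_left₀ (n := 4) (by norm_num) (dist_nonneg x y) ?_
  rw [dist_pow_four, dist4]
  have := sq_nonneg (y.2 - x.2 - 2 * symp x.1 y.1)
  linarith

lemma abs_snd_sub_le_dist_sq (x y : Heis n) :
    |y.2 - x.2 - 2 * symp x.1 y.1| ≤ dist x y ^ 2 := by
  apply abs_le_of_sq_le_sq _ (by positivity)
  have h := dist_pow_four x y
  rw [dist4] at h
  have : 0 ≤ ‖y.1 - x.1‖ ^ 4 := by positivity
  nlinarith

/-- The complex number whose modulus is the square of the Koranyi distance. -/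
def cdist (x y : Heis n) : ℂ := ⟨‖y.1 - x.1‖ ^ 2, y.2 - x.2 - 2 * symp x.1 y.1⟩

lemma norm_cdist (x y : Heis n) : ‖cdist x y‖ = dist x y ^ 2 := by
  rw [← sq_eq_sq₀ (norm_nonneg _) (by positivity), Complex.sq_norm, Complex.normSq_apply,
    ← pow_mul, dist_pow_four]
  simp only [cdist, dist4]; ring

/-- The triangle inequality: `cdist` is additive up to twice the Hermitian product of the horizontal
increments. -/
lemma dist_triangle (x y z : Heis n) : dist x z ≤ dist x y + dist y z := by
  have hab : 0 ≤ dist x y + dist y z := add_nonneg (dist_nonneg _ _) (dist_nonneg _ _)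
  refine le_of_pow_le_pow_left₀ (n := 2) (by norm_num) hab ?_
  obtain ⟨u, hu⟩ : ∃ u, u = y.1 - x.1 := ⟨_, rfl⟩
  obtain ⟨v, hv⟩ : ∃ v, v = z.1 - y.1 := ⟨_, rfl⟩
  have e : cdist x z = cdist x y + cdist y z + 2 * (⟨inner ℝ u v, symp u v⟩ : ℂ) := by
    have huv : z.1 - x.1 = u + v := by simp [hu, hv]
    have hs : symp u v = symp y.1 z.1 - symp x.1 z.1 + symp x.1 y.1 := by
      simp only [hu, hv, symp_sub_left, symp_sub_right, symp_self]; ring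
    apply Complex.ext
    · simp [cdist, huv, norm_add_sq_real, ← hu, ← hv]
      ring
    · simp only [cdist, Complex.add_im, Complex.mul_im, Complex.re_ofNat, Complex.im_ofNat, hs]
      ring
  have hn : ‖(⟨inner ℝ u v, symp u v⟩ : ℂ)‖ ≤ dist x y * dist y z := by
    rw [hu, hv]
    refine le_trans ?_ (mul_le_mul (norm_fst_sub_le_dist x y) (norm_fst_sub_le_dist y z)
      (norm_nonneg _) (dist_nonneg _ _))
    refine le_of_pow_le_pow_left₀ (n := 2) (by norm_num) (by positivity) ?_
    rw [Complex.sq_norm, Complex.normSq_apply, mul_pow]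
    simpa only [sq] using inner_sq_add_symp_sq_le (y.1 - x.1) (z.1 - y.1)
  calc dist x z ^ 2 = ‖cdist x z‖ := (norm_cdist _ _).symm
    _ ≤ ‖cdist x y‖ + ‖cdist y z‖ + 2 * ‖(⟨inner ℝ u v, symp u v⟩ : ℂ)‖ := by
        rw [e]
        refine (norm_add₃_le).trans ?_
        simp
    _ ≤ dist x y ^ 2 + dist y z ^ 2 + 2 * (dist x y * dist y z) := by
        rw [norm_cdist, norm_cdist]; linarith
    _ = (dist x y + dist y z) ^ 2 := by ring

@[fun_prop]
lemma continuous_symp {X : Type*} [TopologicalSpace X]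
    {f g : X → EuclideanSpace ℝ (Fin n ⊕ Fin n)} (hf : Continuous f) (hg : Continuous g) :
    Continuous fun x => symp (f x) (g x) := by
  simp only [symp_apply]; fun_prop

@[fun_prop]
lemma continuous_dist4 {X : Type*} [TopologicalSpace X] {f g : X → Heis n}
    (hf : Continuous f) (hg : Continuous g) : Continuous fun x => dist4 (f x) (g x) := by
  unfold dist4; fun_prop

@[fun_prop]
lemma continuous_dist {X : Type*} [TopologicalSpace X] {f g : X → Heis n}
    (hf : Continuous f) (hg : Continuous g) : Continuous fun x => dist (f x) (g x) := by
  simp only [dist_eq_rpow]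
  exact (continuous_dist4 hf hg).rpow_const fun _ => Or.inr (by norm_num)

@[fun_prop]
lemma continuous_dil (r : ℝ) : Continuous (dil r : Heis n → Heis n) := by
  unfold dil; fun_prop

lemma dist4_dil (r : ℝ) (x y : Heis n) : dist4 (dil r x) (dil r y) = r ^ 4 * dist4 x y := by
  simp only [dist4, dil, ← smul_sub, norm_smul, symp_smul_left, symp_smul_right, mul_pow,
    Real.norm_eq_abs]
  rw [show |r| ^ 4 = r ^ 4 from by rw [show 4 = 2 * 2 from rfl, pow_mul, sq_abs, pow_mul]]
  ring

lemma dist_dil {r : ℝ} (hr : 0 ≤ r) (x y : Heis n) :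
    dist (dil r x) (dil r y) = r * dist x y := by
  refine (pow_left_inj₀ (dist_nonneg _ _) (mul_nonneg hr (dist_nonneg _ _))
    (n := 4) (by norm_num)).1 ?_
  simp only [mul_pow, dist_pow_four, dist4_dil]

@[simp] lemma dil_zero_right (r : ℝ) : dil r (0 : Heis n) = 0 := by ext <;> simp [dil]

lemma dil_dil (r s : ℝ) (x : Heis n) : dil r (dil s x) = dil (r * s) x := by
  ext
  · simp [dil, mul_assoc]
  · simp [dil]; ring

@[simp] lemma dil_one (x : Heis n) : dil 1 x = x := by ext <;> simp [dil]

lemma isClosed_ball (x : Heis n) (t : ℝ) : IsClosed (ball x t) :=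
  isClosed_le (by fun_prop) continuous_const

lemma measurableSet_ball (x : Heis n) (t : ℝ) : MeasurableSet (ball x t) :=
  (isClosed_ball x t).measurableSet

lemma ball_subset_ball_add {x y : Heis n} (t : ℝ) : ball x t ⊆ ball y (t + dist x y) :=
  fun z hz => (dist_triangle z x y).trans (add_le_add_left hz _)

lemma ball_subset_closedBall (x : Heis n) (t : ℝ) :
    ball x t ⊆ Metric.closedBall x (max t (t ^ 2 + 2 * (t * ‖x.1‖))) := by
  intro z hz
  have hz' : dist x z ≤ t := by rw [dist_comm]; exact hz
  have h1 := (norm_fst_sub_le_dist x z).trans hz'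
  have h2 := (abs_snd_sub_le_dist_sq x z).trans (pow_le_pow_left₀ (dist_nonneg _ _) hz' 2)
  have h3 : |symp x.1 z.1| ≤ t * ‖x.1‖ := by
    have : symp x.1 z.1 = symp x.1 (z.1 - x.1) := by rw [symp_sub_right, symp_self, sub_zero]
    rw [this, mul_comm]
    exact (abs_symp_le _ _).trans (mul_le_mul_of_nonneg_left h1 (norm_nonneg _))
  rw [Metric.mem_closedBall, Prod.dist_eq]
  refine max_le_max ?_ ?_
  · rwa [dist_eq_norm]
  · rw [Real.dist_eq]
    rw [abs_le] at *
    constructor <;> linarith [h2.1, h2.2, h3.1, h3.2]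

lemma isCompact_ball (x : Heis n) (t : ℝ) : IsCompact (ball x t) := by
  rcases lt_or_ge t 0 with ht | ht
  · convert isCompact_empty
    ext z
    simpa [ball] using ht.trans_le (dist_nonneg z x)
  · exact (isCompact_closedBall x _).of_isClosed_subset (isClosed_ball x t)
      (ball_subset_closedBall x t)

lemma exists_ball_subset {x : Heis n} {U : Set (Heis n)} (hU : U ∈ 𝓝 x) :
    ∃ t > 0, ball x t ⊆ U := by
  obtain ⟨ε, hε, h⟩ := Metric.nhds_basis_closedBall.mem_iff.1 hU
  have hlim : Tendsto (fun t : ℝ => max t (t ^ 2 + 2 * (t * ‖x.1‖))) (𝓝[>] 0) (𝓝 0) := by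
    have : Continuous fun t : ℝ => max t (t ^ 2 + 2 * (t * ‖x.1‖)) := by fun_prop
    simpa using (this.tendsto 0).mono_left nhdsWithin_le_nhds
  obtain ⟨t, ht, ht0⟩ := ((hlim.eventually (gt_mem_nhds hε)).and self_mem_nhdsWithin).exists
  exact ⟨t, ht0, (ball_subset_closedBall x t).trans
    ((Metric.closedBall_subset_closedBall ht.le).trans h)⟩

lemma ball_mem_nhds (x : Heis n) {t : ℝ} (ht : 0 < t) : ball x t ∈ 𝓝 x := by
  have h : {z : Heis n | dist z x < t} ∈ 𝓝 x :=
    (isOpen_lt (by fun_prop) continuous_const).mem_nhds (by simpa using ht)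
  exact mem_of_superset h fun z (hz : dist z x < t) => hz.le

lemma exists_subset_ball {K : Set (Heis n)} (hK : IsCompact K) : ∃ R > 0, K ⊆ ball 0 R := by
  obtain ⟨R, hR⟩ := (hK.image (f := fun z => dist z (0 : Heis n)) (by fun_prop)).bddAbove
  refine ⟨max R 1, by positivity, fun z hz => ?_⟩
  exact (hR ⟨z, hz, rfl⟩).trans (le_max_left _ _)

/-! ### Graded expansion of the exponential -/

/-- The term with exponents `i` in the expansion of `exp (α + β + γ + δ)`. -/
def expTerm (α β γ δ : ℝ) (i : ℕ × ℕ × ℕ × ℕ) : ℝ :=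
  α ^ i.1 / i.1.factorial * (β ^ i.2.1 / i.2.1.factorial *
    (γ ^ i.2.2.1 / i.2.2.1.factorial * (δ ^ i.2.2.2 / i.2.2.2.factorial)))

/-- The exponents of total weight `j`, where the four variables have weights `1, 2, 3, 4`. -/
def expIndex (j : ℕ) : Finset (ℕ × ℕ × ℕ × ℕ) :=
  (Finset.range (j + 1) ×ˢ Finset.range (j + 1) ×ˢ Finset.range (j + 1) ×ˢ
    Finset.range (j + 1)).filter fun i => i.1 + 2 * i.2.1 + 3 * i.2.2.1 + 4 * i.2.2.2 = j

lemma mem_expIndex {j : ℕ} {i : ℕ × ℕ × ℕ × ℕ} :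
    i ∈ expIndex j ↔ i.1 + 2 * i.2.1 + 3 * i.2.2.1 + 4 * i.2.2.2 = j := by
  simp only [expIndex, Finset.mem_filter, Finset.mem_product, Finset.mem_range]
  omega

/-- The coefficient of `t ^ j` in `exp (α t + β t² + γ t³ + δ t⁴)`. -/
def expCoef (α β γ δ : ℝ) (j : ℕ) : ℝ := ∑ i ∈ expIndex j, expTerm α β γ δ i

lemma hasSum_mul_prod {ι κ : Type*} {f : ι → ℝ} {g : κ → ℝ} {a b : ℝ} (hf : HasSum f a)
    (hg : HasSum g b) : HasSum (fun i : ι × κ => f i.1 * g i.2) (a * b) :=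
  hf.mul hg (Summable.of_norm (hf.summable.norm.mul_norm hg.summable.norm))

lemma hasSum_expTerm (α β γ δ : ℝ) :
    HasSum (expTerm α β γ δ) (Real.exp (α + β + γ + δ)) := by
  have h (a : ℝ) : HasSum (fun i : ℕ => a ^ i / (i.factorial : ℝ)) (Real.exp a) := by
    rw [Real.exp_eq_exp_ℝ]
    exact NormedSpace.expSeries_div_hasSum_exp a
  have hs : Real.exp (α + β + γ + δ) =
      Real.exp α * (Real.exp β * (Real.exp γ * Real.exp δ)) := by
    rw [← Real.exp_add, ← Real.exp_add, ← Real.exp_add]; ring_nf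
  rw [hs]
  exact hasSum_mul_prod (h α) (hasSum_mul_prod (h β) (hasSum_mul_prod (h γ) (h δ)))

lemma hasSum_expCoef (α β γ δ : ℝ) :
    HasSum (expCoef α β γ δ) (Real.exp (α + β + γ + δ)) := by
  let w : ℕ × ℕ × ℕ × ℕ → ℕ := fun i => i.1 + 2 * i.2.1 + 3 * i.2.2.1 + 4 * i.2.2.2
  have h := (hasSum_expTerm α β γ δ).tsum_fiberwise w
  have hw (j : ℕ) : w ⁻¹' {j} = (expIndex j : Set (ℕ × ℕ × ℕ × ℕ)) := by
    ext i; simp [w, mem_expIndex]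
  have he : expCoef α β γ δ = fun j => ∑' i : w ⁻¹' {j}, expTerm α β γ δ i := by
    funext j
    rw [hw, Finset.tsum_subtype', expCoef]
  rw [he]
  exact h

lemma abs_expCoef_le (α β γ δ : ℝ) (j : ℕ) :
    |expCoef α β γ δ j| ≤ expCoef |α| |β| |γ| |δ| j := by
  refine (Finset.abs_sum_le_sum_abs _ _).trans (le_of_eq (Finset.sum_congr rfl fun i _ => ?_))
  simp [expTerm, abs_mul, abs_div, abs_pow]

lemma expCoef_smul (α β γ δ ρ : ℝ) (j : ℕ) :
    expCoef (ρ * α) (ρ ^ 2 * β) (ρ ^ 3 * γ) (ρ ^ 4 * δ) j = ρ ^ j * expCoef α β γ δ j := by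
  rw [expCoef, expCoef, Finset.mul_sum]
  refine Finset.sum_congr rfl fun i hi => ?_
  rw [← mem_expIndex.1 hi]
  simp only [expTerm, pow_add, pow_mul, mul_pow]
  ring

lemma expCoef_zero (α β γ δ : ℝ) : expCoef α β γ δ 0 = 1 := by
  have : expIndex 0 = {(0, 0, 0, 0)} := by
    ext ⟨a, b, c, d⟩; simp only [mem_expIndex, Finset.mem_singleton, Prod.mk.injEq]; omega
  simp [expCoef, this, expTerm]

/-- Tail estimate for a power series dominated by a convergent series. -/
lemma abs_sub_sum_range_le {c b : ℕ → ℝ} {ρ E B : ℝ} (hρ0 : 0 ≤ ρ) (hρ1 : ρ ≤ 1)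
    (hE : HasSum (fun j => ρ ^ j * c j) E) (hB : HasSum b B) (hcb : ∀ j, |c j| ≤ b j) (k : ℕ) :
    |E - ∑ j ∈ Finset.range k, ρ ^ j * c j| ≤ ρ ^ k * B := by
  have hb0 : ∀ j, 0 ≤ b j := fun j => (abs_nonneg _).trans (hcb j)
  have h1 := (hasSum_nat_add_iff' k).2 hE
  have h2 := (hasSum_nat_add_iff' k).2 hB
  have h3 : HasSum (fun j => ρ ^ k * b (j + k)) (ρ ^ k * (B - ∑ i ∈ Finset.range k, b i)) :=
    h2.mul_left _
  have h4 : ∀ j, ‖ρ ^ (j + k) * c (j + k)‖ ≤ ρ ^ k * b (j + k) := by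
    intro j
    rw [norm_mul, norm_pow, Real.norm_of_nonneg hρ0, Real.norm_eq_abs]
    exact mul_le_mul (pow_le_pow_of_le_one hρ0 hρ1 (by omega)) (hcb _) (abs_nonneg _)
      (by positivity)
  have h5 := tsum_of_norm_bounded h3 h4
  rw [h1.tsum_eq, Real.norm_eq_abs] at h5
  refine h5.trans (mul_le_mul_of_nonneg_left ?_ (by positivity))
  linarith [Finset.sum_nonneg fun i (_ : i ∈ Finset.range k) => hb0 i]

/-! ### Graded expansion of the kernel -/

/-- The part of `-s * dist4 x z` of weighted degree `1` in `x`. -/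
def kpart₁ (s : ℝ) (x z : Heis n) : ℝ :=
  s * (4 * (inner ℝ x.1 z.1 * ‖z.1‖ ^ 2 + symp x.1 z.1 * z.2))

/-- The part of `-s * dist4 x z` of weighted degree `2` in `x`. -/
def kpart₂ (s : ℝ) (x z : Heis n) : ℝ :=
  -(s * (2 * ‖x.1‖ ^ 2 * ‖z.1‖ ^ 2 + 4 * inner ℝ x.1 z.1 ^ 2 + 4 * symp x.1 z.1 ^ 2
    - 2 * x.2 * z.2))

/-- The part of `-s * dist4 x z` of weighted degree `3` in `x`. -/
def kpart₃ (s : ℝ) (x z : Heis n) : ℝ :=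
  s * (4 * inner ℝ x.1 z.1 * ‖x.1‖ ^ 2 - 4 * symp x.1 z.1 * x.2)

/-- The part of `-s * dist4 x z` of weighted degree `4` in `x`; it does not depend on `z`. -/
def kpart₄ (s : ℝ) (x : Heis n) : ℝ := -(s * (‖x.1‖ ^ 4 + x.2 ^ 2))

lemma neg_mul_dist4_eq (s : ℝ) (x z : Heis n) :
    -s * dist4 x z =
      -s * dist4 0 z + (kpart₁ s x z + kpart₂ s x z + kpart₃ s x z + kpart₄ s x) := by
  have h : ‖z.1 - x.1‖ ^ 4 = (‖z.1‖ ^ 2 - 2 * inner ℝ x.1 z.1 + ‖x.1‖ ^ 2) ^ 2 := by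
    rw [real_inner_comm, ← norm_sub_sq_real]; ring
  simp only [dist4, h, kpart₁, kpart₂, kpart₃, kpart₄, Prod.fst_zero, Prod.snd_zero, sub_zero,
    symp_zero_left]
  ring

/-- The homogeneous component of degree `j` in `x`, for the dilations of the group, of
`exp (-s * (dist4 x z - dist4 0 z))`. -/
def kcoef (s : ℝ) (x z : Heis n) (j : ℕ) : ℝ :=
  expCoef (kpart₁ s x z) (kpart₂ s x z) (kpart₃ s x z) (kpart₄ s x) j

/-- An upper bound for the absolute convergence of the expansion into homogeneous components. -/
def kbound (s : ℝ) (x z : Heis n) : ℝ :=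
  Real.exp (|kpart₁ s x z| + |kpart₂ s x z| + |kpart₃ s x z| + |kpart₄ s x|)

lemma kcoef_dil (s ρ : ℝ) (x z : Heis n) (j : ℕ) :
    kcoef s (dil ρ x) z j = ρ ^ j * kcoef s x z j := by
  rw [kcoef, kcoef, ← expCoef_smul]
  congr 1
  · simp only [kpart₁, dil, inner_smul_left, symp_smul_left, RCLike.conj_to_real]; ring
  · simp only [kpart₂, dil, inner_smul_left, symp_smul_left, RCLike.conj_to_real, norm_smul,
      mul_pow, Real.norm_eq_abs, sq_abs]; ring
  · simp only [kpart₃, dil, inner_smul_left, symp_smul_left, RCLike.conj_to_real, norm_smul,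
      mul_pow, Real.norm_eq_abs, sq_abs]; ring
  · simp only [kpart₄, dil, norm_smul, mul_pow, Real.norm_eq_abs]
    rw [show |ρ| ^ 4 = ρ ^ 4 from by rw [show 4 = 2 * 2 from rfl, pow_mul, sq_abs, pow_mul]]
    ring

lemma kcoef_zero (s : ℝ) (x z : Heis n) : kcoef s x z 0 = 1 := expCoef_zero _ _ _ _

lemma hasSum_kcoef (s : ℝ) (x z : Heis n) :
    HasSum (kcoef s x z) (Real.exp (-s * dist4 x z + s * dist4 0 z)) := by
  have h := hasSum_expCoef (kpart₁ s x z) (kpart₂ s x z) (kpart₃ s x z) (kpart₄ s x)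
  rwa [neg_mul_dist4_eq, show ∀ a b : ℝ, -s * a + b + s * a = b from fun a b => by ring]

/-- The dominating series. -/
def kabs (s : ℝ) (x z : Heis n) (j : ℕ) : ℝ :=
  expCoef |kpart₁ s x z| |kpart₂ s x z| |kpart₃ s x z| |kpart₄ s x| j

lemma abs_kcoef_le (s : ℝ) (x z : Heis n) (j : ℕ) : |kcoef s x z j| ≤ kabs s x z j :=
  abs_expCoef_le _ _ _ _ _

lemma hasSum_kabs (s : ℝ) (x z : Heis n) : HasSum (kabs s x z) (kbound s x z) :=
  hasSum_expCoef _ _ _ _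

lemma abs_kcoef_le_kbound (s : ℝ) (x z : Heis n) (j : ℕ) : |kcoef s x z j| ≤ kbound s x z :=
  (abs_kcoef_le s x z j).trans (le_hasSum (hasSum_kabs s x z) j fun i _ =>
    (abs_nonneg _).trans (abs_kcoef_le s x z i))

/-- Taylor's formula at `0`, in the direction of `x`, for the kernel. -/
lemma abs_kernel_sub_sum_le (s : ℝ) (x z : Heis n) {ρ : ℝ} (hρ0 : 0 ≤ ρ) (hρ1 : ρ ≤ 1) (k : ℕ) :
    |Real.exp (-s * dist4 (dil ρ x) z + s * dist4 0 z) - 1 -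
      ∑ j ∈ Finset.range k, ρ ^ (j + 1) * kcoef s x z (j + 1)| ≤ ρ ^ (k + 1) * kbound s x z := by
  have h : HasSum (fun j => ρ ^ j * kcoef s x z j)
      (Real.exp (-s * dist4 (dil ρ x) z + s * dist4 0 z)) := by
    simpa only [← kcoef_dil] using hasSum_kcoef s (dil ρ x) z
  have h2 := abs_sub_sum_range_le hρ0 hρ1 h (hasSum_kabs s x z) (abs_kcoef_le s x z) (k + 1)
  rw [Finset.sum_range_succ'] at h2
  rw [kcoef_zero] at h2
  convert h2 using 2
  ring

lemma continuous_kcoef (s : ℝ) (x : Heis n) (j : ℕ) : Continuous fun z => kcoef s x z j := by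
  unfold kcoef expCoef expTerm kpart₁ kpart₂ kpart₃
  fun_prop

lemma continuous_kcoef_left (s : ℝ) (z : Heis n) (j : ℕ) : Continuous fun x => kcoef s x z j := by
  unfold kcoef expCoef expTerm kpart₁ kpart₂ kpart₃ kpart₄
  fun_prop

lemma continuous_kbound (s : ℝ) (x : Heis n) : Continuous fun z => kbound s x z := by
  unfold kbound kpart₁ kpart₂ kpart₃
  fun_prop

/-- All homogeneous components together are absorbed by a fraction of the exponential decay,
since they are exponentials of polynomials of degree at most `3` in `z`. -/
lemma exists_kbound_le {s : ℝ} (hs : 0 < s) (x : Heis n) :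
    ∃ C, ∀ z, Real.exp (-s * dist4 0 z) * kbound s x z ≤ C * Real.exp (-(s / 2) * dist4 0 z) := by
  set a := ‖x.1‖
  set b := |x.2|
  have ha : 0 ≤ a := norm_nonneg _
  have hb : 0 ≤ b := abs_nonneg _
  obtain ⟨K, hK⟩ : ∃ K, K = s * (8 * a + 10 * a ^ 2 + 2 * b + 4 * a ^ 3 + 4 * a * b +
    a ^ 4 + b ^ 2) := ⟨_, rfl⟩
  have hK0 : 0 ≤ K := by rw [hK]; positivity
  obtain ⟨R, hR⟩ : ∃ R, R = 2 * K / s := ⟨_, rfl⟩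
  have hR0 : 0 ≤ R := by rw [hR]; positivity
  refine ⟨Real.exp (K * (1 + R ^ 3)), fun z => ?_⟩
  rw [kbound, ← Real.exp_add, ← Real.exp_add, Real.exp_le_exp, ← dist_pow_four]
  set N := dist 0 z
  have hN : 0 ≤ N := dist_nonneg _ _
  have hz1 : ‖z.1‖ ≤ N := by simpa using norm_fst_sub_le_dist 0 z
  have hz2 : |z.2| ≤ N ^ 2 := by simpa using abs_snd_sub_le_dist_sq 0 z
  have hi : |inner ℝ x.1 z.1| ≤ a * N :=
    (abs_real_inner_le_norm _ _).trans (mul_le_mul_of_nonneg_left hz1 ha)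
  have hw : |symp x.1 z.1| ≤ a * N :=
    (abs_symp_le _ _).trans (mul_le_mul_of_nonneg_left hz1 ha)
  have hz1' : ‖z.1‖ ^ 2 ≤ N ^ 2 := pow_le_pow_left₀ (norm_nonneg _) hz1 2
  have h1 : |kpart₁ s x z| ≤ s * (8 * a * N ^ 3) := by
    rw [kpart₁, abs_mul, abs_of_pos hs, abs_mul]
    refine mul_le_mul_of_nonneg_left ?_ hs.le
    have e1 : |inner ℝ x.1 z.1 * ‖z.1‖ ^ 2| ≤ a * N * N ^ 2 := by
      rw [abs_mul, abs_of_nonneg (by positivity : (0:ℝ) ≤ ‖z.1‖ ^ 2)]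
      exact mul_le_mul hi hz1' (by positivity) (by positivity)
    have e2 : |symp x.1 z.1 * z.2| ≤ a * N * N ^ 2 := by
      rw [abs_mul]
      exact mul_le_mul hw hz2 (by positivity) (by positivity)
    have e3 := abs_add_le (inner ℝ x.1 z.1 * ‖z.1‖ ^ 2) (symp x.1 z.1 * z.2)
    rw [abs_of_pos (by norm_num : (0:ℝ) < 4)]
    linarith
  have hi2 : inner ℝ x.1 z.1 ^ 2 ≤ (a * N) ^ 2 := sq_le_sq' (abs_le.1 hi).1 (abs_le.1 hi).2
  have hw2 : symp x.1 z.1 ^ 2 ≤ (a * N) ^ 2 := sq_le_sq' (abs_le.1 hw).1 (abs_le.1 hw).2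
  have h2 : |kpart₂ s x z| ≤ s * ((10 * a ^ 2 + 2 * b) * N ^ 2) := by
    rw [kpart₂, abs_neg, abs_mul, abs_of_pos hs]
    refine mul_le_mul_of_nonneg_left ?_ hs.le
    have e1 : a ^ 2 * ‖z.1‖ ^ 2 ≤ a ^ 2 * N ^ 2 := mul_le_mul_of_nonneg_left hz1' (by positivity)
    have e2 : |x.2 * z.2| ≤ b * N ^ 2 := by
      rw [abs_mul]; exact mul_le_mul_of_nonneg_left hz2 hb
    have e4 : 0 ≤ a ^ 2 * ‖z.1‖ ^ 2 := by positivity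
    rw [abs_le] at e2 ⊢
    constructor <;> nlinarith [sq_nonneg (inner ℝ x.1 z.1 : ℝ), sq_nonneg (symp x.1 z.1)]
  have h3 : |kpart₃ s x z| ≤ s * ((4 * a ^ 3 + 4 * a * b) * N) := by
    rw [kpart₃, abs_mul, abs_of_pos hs]
    refine mul_le_mul_of_nonneg_left ?_ hs.le
    have e1 : |inner ℝ x.1 z.1 * a ^ 2| ≤ a * N * a ^ 2 := by
      rw [abs_mul, abs_of_nonneg (by positivity : (0:ℝ) ≤ a ^ 2)]
      exact mul_le_mul_of_nonneg_right hi (by positivity)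
    have e2 : |symp x.1 z.1 * x.2| ≤ a * N * b := by
      rw [abs_mul]
      exact mul_le_mul_of_nonneg_right hw hb
    rw [abs_le] at e1 e2 ⊢
    constructor <;> linarith [e1.1, e1.2, e2.1, e2.2]
  have h4 : |kpart₄ s x| ≤ s * (a ^ 4 + b ^ 2) := by
    rw [kpart₄, abs_neg, abs_mul, abs_of_pos hs, abs_of_nonneg (by positivity), sq_abs]
  have hN1 : N ≤ 1 + N ^ 3 := by nlinarith [sq_nonneg (N - 1), sq_nonneg N]
  have hN2 : N ^ 2 ≤ 1 + N ^ 3 := by nlinarith [sq_nonneg (N - 1), sq_nonneg N]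
  have hN3 : 0 ≤ N ^ 3 := by positivity
  have hsum : |kpart₁ s x z| + |kpart₂ s x z| + |kpart₃ s x z| + |kpart₄ s x| ≤
      K * (1 + N ^ 3) := by
    have e1 : s * (8 * a * N ^ 3) ≤ s * (8 * a * (1 + N ^ 3)) := by gcongr; linarith
    have e2 : s * ((10 * a ^ 2 + 2 * b) * N ^ 2) ≤
      s * ((10 * a ^ 2 + 2 * b) * (1 + N ^ 3)) := by gcongr
    have e3 : s * ((4 * a ^ 3 + 4 * a * b) * N) ≤
      s * ((4 * a ^ 3 + 4 * a * b) * (1 + N ^ 3)) := by gcongr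
    have e4 : s * (a ^ 4 + b ^ 2) ≤ s * ((a ^ 4 + b ^ 2) * (1 + N ^ 3)) := by
      gcongr
      exact le_mul_of_one_le_right (by positivity) (by linarith)
    rw [hK]
    linarith
  have habsorb : K * N ^ 3 ≤ K * R ^ 3 + s / 2 * N ^ 4 := by
    rcases le_total N R with h | h
    · have : K * N ^ 3 ≤ K * R ^ 3 := by gcongr
      have : 0 ≤ s / 2 * N ^ 4 := by positivity
      linarith
    · have hKR : K = s / 2 * R := by rw [hR]; field_simp
      have h1 : s / 2 * R * N ^ 3 ≤ s / 2 * N * N ^ 3 := by gcongr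
      have h2 : 0 ≤ K * R ^ 3 := by positivity
      rw [← hKR] at h1
      linarith
  linarith

/-! ### Homogeneous polynomials and interpolation at the points of a set -/

/-- The space spanned by the constants and the coordinate functions of `ℍⁿ`. -/
def affineFun (n : ℕ) : Submodule ℝ (Heis n → ℝ) :=
  Submodule.span ℝ ({1, fun x => x.2} ∪ Set.range fun i (x : Heis n) => x.1 i)

lemma affineFun_pow_fg (j : ℕ) : (affineFun n ^ j).FG :=
  Submodule.FG.pow (Submodule.fg_span ((Set.toFinite _).union (Set.finite_range _))) j

lemma one_mem_affineFun : (1 : Heis n → ℝ) ∈ affineFun n :=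
  Submodule.subset_span (by simp)

lemma snd_mem_affineFun : (fun x : Heis n => x.2) ∈ affineFun n :=
  Submodule.subset_span (by simp)

lemma coord_mem_affineFun (i : Fin n ⊕ Fin n) : (fun x : Heis n => x.1 i) ∈ affineFun n :=
  Submodule.subset_span (by simp)

lemma affineFun_pow_mono {i j : ℕ} (h : i ≤ j) : affineFun n ^ i ≤ affineFun n ^ j := by
  obtain ⟨k, rfl⟩ := Nat.exists_eq_add_of_le h
  intro f hf
  rw [pow_add, ← mul_one f]
  have h1 := Submodule.pow_mem_pow (affineFun n) one_mem_affineFun k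
  rw [one_pow] at h1
  exact Submodule.mul_mem_mul hf h1

lemma mul_mem_affineFun_pow {i j k : ℕ} (h : i + j = k) {f g : Heis n → ℝ}
    (hf : f ∈ affineFun n ^ i) (hg : g ∈ affineFun n ^ j) :
    (fun x => f x * g x) ∈ affineFun n ^ k := by
  rw [← h, pow_add]
  exact Submodule.mul_mem_mul hf hg

lemma pow_mem_affineFun_pow {i j k : ℕ} (h : i * j = k) {f : Heis n → ℝ}
    (hf : f ∈ affineFun n ^ i) : (fun x => f x ^ j) ∈ affineFun n ^ k := by
  rw [← h, pow_mul]
  exact Submodule.pow_mem_pow _ hf j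

lemma inner_mem_affineFun (v : EuclideanSpace ℝ (Fin n ⊕ Fin n)) :
    (fun x : Heis n => (inner ℝ x.1 v : ℝ)) ∈ affineFun n ^ 1 := by
  rw [pow_one]
  have : (fun x : Heis n => (inner ℝ x.1 v : ℝ)) = ∑ i, v i • fun x : Heis n => x.1 i := by
    ext x
    simp [PiLp.inner_apply]
  rw [this]
  exact Submodule.sum_mem _ fun i _ => Submodule.smul_mem _ _ (coord_mem_affineFun i)

lemma symp_mem_affineFun (v : EuclideanSpace ℝ (Fin n ⊕ Fin n)) :
    (fun x : Heis n => symp x.1 v) ∈ affineFun n ^ 1 :=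
  inner_mem_affineFun _

lemma norm_sq_mem_affineFun : (fun x : Heis n => ‖x.1‖ ^ 2) ∈ affineFun n ^ 2 := by
  have : (fun x : Heis n => ‖x.1‖ ^ 2) = ∑ i, fun x : Heis n => x.1 i ^ 2 := by
    ext x
    simp [EuclideanSpace.norm_sq_eq]
  rw [this]
  refine Submodule.sum_mem _ fun i _ => pow_mem_affineFun_pow (one_mul 2) ?_
  rw [pow_one]
  exact coord_mem_affineFun i

lemma kpart₁_mem (s : ℝ) (z : Heis n) : (fun x => kpart₁ s x z) ∈ affineFun n ^ 1 := by
  have : (fun x => kpart₁ s x z) = (4 * s * ‖z.1‖ ^ 2) • (fun x : Heis n => (inner ℝ x.1 z.1 : ℝ))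
      + (4 * s * z.2) • fun x : Heis n => symp x.1 z.1 := by
    ext x; simp only [kpart₁, Pi.add_apply, Pi.smul_apply, smul_eq_mul]; ring
  rw [this]
  exact add_mem (Submodule.smul_mem _ _ (inner_mem_affineFun _))
    (Submodule.smul_mem _ _ (symp_mem_affineFun _))

lemma kpart₂_mem (s : ℝ) (z : Heis n) : (fun x => kpart₂ s x z) ∈ affineFun n ^ 2 := by
  have : (fun x => kpart₂ s x z) = (-(2 * s * ‖z.1‖ ^ 2)) • (fun x : Heis n => ‖x.1‖ ^ 2)
      + (-(4 * s)) • (fun x : Heis n => (inner ℝ x.1 z.1 : ℝ) ^ 2)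
      + (-(4 * s)) • (fun x : Heis n => symp x.1 z.1 ^ 2)
      + (2 * s * z.2) • fun x : Heis n => x.2 := by
    ext x; simp only [kpart₂, Pi.add_apply, Pi.smul_apply, smul_eq_mul]; ring
  rw [this]
  refine add_mem (add_mem (add_mem (Submodule.smul_mem _ _ norm_sq_mem_affineFun)
    (Submodule.smul_mem _ _ (pow_mem_affineFun_pow (one_mul 2) (inner_mem_affineFun _))))
    (Submodule.smul_mem _ _ (pow_mem_affineFun_pow (one_mul 2) (symp_mem_affineFun _))))
    (Submodule.smul_mem _ _ (affineFun_pow_mono one_le_two ?_))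
  rw [pow_one]
  exact snd_mem_affineFun

lemma kpart₃_mem (s : ℝ) (z : Heis n) : (fun x => kpart₃ s x z) ∈ affineFun n ^ 3 := by
  have : (fun x => kpart₃ s x z) = (4 * s) • (fun x : Heis n => (inner ℝ x.1 z.1 : ℝ) * ‖x.1‖ ^ 2)
      + (-(4 * s)) • (fun x : Heis n => symp x.1 z.1 * x.2) := by
    ext x; simp only [kpart₃, Pi.add_apply, Pi.smul_apply, smul_eq_mul]; ring
  rw [this]
  refine add_mem (Submodule.smul_mem _ _ (mul_mem_affineFun_pow rfl (inner_mem_affineFun _)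
    norm_sq_mem_affineFun)) (Submodule.smul_mem _ _ (affineFun_pow_mono (by norm_num)
    (mul_mem_affineFun_pow (i := 1) (j := 1) rfl (symp_mem_affineFun _) ?_)))
  rw [pow_one]
  exact snd_mem_affineFun

lemma kpart₄_mem (s : ℝ) : (fun x : Heis n => kpart₄ s x) ∈ affineFun n ^ 4 := by
  have : (fun x : Heis n => kpart₄ s x) = (-s) • (fun x : Heis n => (‖x.1‖ ^ 2) ^ 2)
      + (-s) • (fun x : Heis n => x.2 ^ 2) := by
    ext x; simp only [kpart₄, Pi.add_apply, Pi.smul_apply, smul_eq_mul]; ring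
  rw [this]
  refine add_mem (Submodule.smul_mem _ _
    (pow_mem_affineFun_pow (i := 2) (j := 2) rfl norm_sq_mem_affineFun))
    (Submodule.smul_mem _ _ (affineFun_pow_mono (by norm_num)
    (pow_mem_affineFun_pow (i := 1) (j := 2) rfl ?_)))
  rw [pow_one]
  exact snd_mem_affineFun

lemma kcoef_mem (s : ℝ) (z : Heis n) (j : ℕ) : (fun x => kcoef s x z j) ∈ affineFun n ^ j := by
  have : (fun x => kcoef s x z j) = ∑ i ∈ expIndex j,
      ((i.1.factorial : ℝ)⁻¹ * (i.2.1.factorial : ℝ)⁻¹ * (i.2.2.1.factorial : ℝ)⁻¹ *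
        (i.2.2.2.factorial : ℝ)⁻¹) • fun x => kpart₁ s x z ^ i.1 * (kpart₂ s x z ^ i.2.1 *
          (kpart₃ s x z ^ i.2.2.1 * kpart₄ s x ^ i.2.2.2)) := by
    ext x
    simp only [kcoef, expCoef, expTerm, Finset.sum_apply, Pi.smul_apply, smul_eq_mul]
    exact Finset.sum_congr rfl fun i _ => by ring
  rw [this]
  refine Submodule.sum_mem _ fun i hi => Submodule.smul_mem _ _ ?_
  exact mul_mem_affineFun_pow (by rw [← mem_expIndex.1 hi]; ring)
    (pow_mem_affineFun_pow rfl (kpart₁_mem s z))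
    (mul_mem_affineFun_pow rfl (pow_mem_affineFun_pow rfl (kpart₂_mem s z))
      (mul_mem_affineFun_pow rfl (pow_mem_affineFun_pow rfl (kpart₃_mem s z))
        (pow_mem_affineFun_pow rfl (kpart₄_mem s))))

/-- A finite-dimensional space of continuous functions on `ℍⁿ`, homogeneous of degree `j` with
respect to the dilations, which contains all the functions `x ↦ kcoef s x z j`. -/
def homPoly (n j : ℕ) : Submodule ℝ (Heis n → ℝ) where
  carrier := {f | f ∈ affineFun n ^ j ∧ Continuous f ∧ ∀ r x, f (dil r x) = r ^ j * f x}
  zero_mem' := ⟨zero_mem _, continuous_zero, by simp⟩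
  add_mem' := fun hf hg => ⟨add_mem hf.1 hg.1, hf.2.1.add hg.2.1, fun r x => by
    simp only [Pi.add_apply, hf.2.2, hg.2.2]; ring⟩
  smul_mem' := fun c f hf => ⟨Submodule.smul_mem _ _ hf.1, hf.2.1.const_smul c, fun r x => by
    simp only [Pi.smul_apply, hf.2.2, smul_eq_mul]; ring⟩

instance (j : ℕ) : FiniteDimensional ℝ (homPoly n j) := by
  have : FiniteDimensional ℝ (affineFun n ^ j : Submodule ℝ (Heis n → ℝ)) :=
    Module.Finite.iff_fg.2 (affineFun_pow_fg j)
  exact Submodule.finiteDimensional_of_le (S₂ := affineFun n ^ j) fun f hf => hf.1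

lemma kcoef_mem_homPoly (s : ℝ) (z : Heis n) (j : ℕ) :
    (fun x => kcoef s x z j) ∈ homPoly n j :=
  ⟨kcoef_mem s z j, continuous_kcoef_left s z j, fun r x => kcoef_dil s r x z j⟩

/-- If `y` is a limit at infinity of blow-downs of points of `S`, the leading form at `y` of a
polynomial of degree `k + 1` without constant term is a fixed combination of the values of the
polynomial at finitely many points of `S`: the leading form at `y` of a polynomial vanishing on
`S` is zero, and the space of polynomials is finite-dimensional. -/
lemma exists_leading_form_eq {S : Set (Heis n)} {l : Filter ℝ} (hl : l ≤ atTop) {y : Heis n}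
    (hy : ∃ᶠ q in l ×ˢ 𝓝 y, dil q.1 q.2 ∈ S) (k : ℕ) :
    ∃ c : S →₀ ℝ, ∀ p : (j : ℕ) → Heis n → ℝ, (∀ j, p j ∈ homPoly n (j + 1)) →
      p k y = c.sum fun x a => a * ∑ j ∈ Finset.range (k + 1), p j x := by
  let E := (j : Fin (k + 1)) → homPoly n (j + 1)
  let ev (j : Fin (k + 1)) (x : Heis n) : E →ₗ[ℝ] ℝ :=
    LinearMap.proj x ∘ₗ (homPoly n (j + 1)).subtype ∘ₗ LinearMap.proj j
  have hev : ∀ j x (p : E), ev j x p = (p j : Heis n → ℝ) x := fun j x p => rfl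
  have key : (⨅ x : S, LinearMap.ker (∑ j, ev j x)) ≤ LinearMap.ker (ev (Fin.last k) y) := by
    intro p hp
    rw [Submodule.mem_iInf] at hp
    rw [LinearMap.mem_ker, hev]
    -- the rescaled polynomial converges to its leading form
    have hterm : ∀ j : Fin (k + 1), Tendsto
        (fun q : ℝ × Heis n => (q.1⁻¹) ^ (k - (j : ℕ)) * (p j : Heis n → ℝ) q.2) (l ×ˢ 𝓝 y)
        (𝓝 (0 ^ (k - (j : ℕ)) * (p j : Heis n → ℝ) y)) := fun j =>
      (((tendsto_inv_atTop_zero.mono_left hl).comp tendsto_fst).pow _).mul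
        (((p j).2.2.1.tendsto y).comp tendsto_snd)
    have hsum := tendsto_finsetSum Finset.univ fun j _ => hterm j
    have hlim : ∑ j : Fin (k + 1), (0 : ℝ) ^ (k - (j : ℕ)) * (p j : Heis n → ℝ) y =
        (p (Fin.last k) : Heis n → ℝ) y := by
      rw [Finset.sum_eq_single (Fin.last k)]
      · simp
      · intro j _ hj
        have : (j : ℕ) < k := Fin.lt_last_iff_ne_last.2 hj
        rw [zero_pow (by omega), zero_mul]
      · simp
    rw [hlim] at hsum
    have hfreq : ∃ᶠ q in l ×ˢ 𝓝 y,
        ∑ j : Fin (k + 1), (q.1⁻¹) ^ (k - (j : ℕ)) * (p j : Heis n → ℝ) q.2 = 0 := by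
      have hpos : ∀ᶠ q : ℝ × Heis n in l ×ˢ 𝓝 y, 0 < q.1 :=
        tendsto_fst.eventually (hl (eventually_gt_atTop 0))
      refine (hy.and_eventually hpos).mono fun q ⟨hq, hq0⟩ => ?_
      have h0 := hp ⟨_, hq⟩
      rw [LinearMap.mem_ker, LinearMap.sum_apply] at h0
      simp only [hev, (p _).2.2.2] at h0
      have : (q.1⁻¹) ^ (k + 1) * ∑ j : Fin (k + 1), q.1 ^ ((j : ℕ) + 1) * (p j : Heis n → ℝ) q.2
          = 0 := by rw [h0, mul_zero]
      rw [Finset.mul_sum] at this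
      rw [← this]
      refine Finset.sum_congr rfl fun j _ => ?_
      have hj : (q.1⁻¹) ^ (k + 1) = (q.1⁻¹) ^ (k - (j : ℕ)) * (q.1⁻¹) ^ ((j : ℕ) + 1) := by
        rw [← pow_add]; congr 1; omega
      rw [hj, ← mul_assoc, mul_assoc _ _ (q.1 ^ _), ← mul_pow, inv_mul_cancel₀ hq0.ne', one_pow,
        mul_one]
    by_contra hne
    exact hfreq (hsum.eventually_ne hne)
  have hmem := FiniteDimensional.mem_span_of_iInf_ker_le_ker key
  obtain ⟨c, hc⟩ := Finsupp.mem_span_range_iff_exists_finsupp.1 hmem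
  refine ⟨c, fun p hp => ?_⟩
  have h := LinearMap.congr_fun hc (fun j => ⟨p j, hp j⟩)
  rw [hev] at h
  refine Eq.trans h.symm ?_
  simp only [Finsupp.sum, LinearMap.sum_apply, LinearMap.smul_apply, hev, smul_eq_mul,
    Finset.sum_range]

/-- The kernel version of the interpolation formula. -/
lemma exists_kcoef_eq {S : Set (Heis n)} {l : Filter ℝ} (hl : l ≤ atTop) {y : Heis n}
    (hy : ∃ᶠ q in l ×ˢ 𝓝 y, dil q.1 q.2 ∈ S) (k : ℕ) :
    ∃ c : S →₀ ℝ, ∀ s ρ z, ρ ^ (k + 1) * kcoef s y z (k + 1) =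
      c.sum fun x a => a * ∑ j ∈ Finset.range (k + 1), ρ ^ (j + 1) * kcoef s x z (j + 1) := by
  obtain ⟨c, hc⟩ := exists_leading_form_eq hl hy k
  refine ⟨c, fun s ρ z => ?_⟩
  exact hc (fun j x => ρ ^ (j + 1) * kcoef s x z (j + 1)) fun j =>
    Submodule.smul_mem _ (ρ ^ (j + 1)) (kcoef_mem_homPoly s z (j + 1))

/-! ### The integral of the kernel against a uniform measure -/

/-- The balls centred at `w` have the `σ`-measure they have for an `m`-uniform measure whose
support contains `w`. -/
def IsUniformAt (m : ℕ) (σ : Measure (Heis n)) (w : Heis n) : Prop :=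
  ∀ t : ℝ, 0 < t → σ (ball w t) = ENNReal.ofReal (t ^ m)

/-- The integral of `exp (-dist4 w z)` against any measure which is `m`-uniform at `w`, computed
by the layer cake formula. -/
def unitConst (m : ℕ) : ℝ≥0∞ :=
  ∫⁻ t in Set.Ioo (0 : ℝ) 1, ENNReal.ofReal (((-Real.log t) ^ (1 / 4 : ℝ)) ^ m)

/-- The integral of `exp (-s * dist4 w z)` against any measure which is `m`-uniform at `w`. -/
def gaussConst (m : ℕ) (s : ℝ) : ℝ≥0∞ :=
  ENNReal.ofReal (((s ^ (1 / 4 : ℝ)) ^ m)⁻¹) * unitConst m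

lemma le_exp_neg_iff {s t : ℝ} (hs : 0 < s) (ht : 0 < t) (ht1 : t < 1) (w z : Heis n) :
    t ≤ Real.exp (-s * dist4 w z) ↔ z ∈ ball w ((-Real.log t / s) ^ (1 / 4 : ℝ)) := by
  have hlog : 0 < -Real.log t / s := div_pos (by linarith [Real.log_neg ht ht1]) hs
  change _ ↔ dist z w ≤ _
  rw [dist_comm, dist_le_iff (Real.rpow_nonneg hlog.le _), ← Real.rpow_natCast,
    ← Real.rpow_mul hlog.le, ← Real.log_le_iff_le_exp ht,
    show (1 / 4 : ℝ) * ((4 : ℕ) : ℝ) = 1 by norm_num, Real.rpow_one, le_div_iff₀ hs]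
  constructor <;> intro h <;> linarith

lemma lintegral_kernel {m : ℕ} {σ : Measure (Heis n)} {w : Heis n} (h : IsUniformAt m σ w)
    {s : ℝ} (hs : 0 < s) :
    ∫⁻ z, ENNReal.ofReal (Real.exp (-s * dist4 w z)) ∂σ = gaussConst m s := by
  have hc : Continuous fun z => Real.exp (-s * dist4 w z) := by fun_prop
  rw [lintegral_eq_lintegral_meas_le σ (ae_of_all _ fun z => (Real.exp_pos _).le)
    hc.measurable.aemeasurable, gaussConst, unitConst,
    ← lintegral_const_mul' _ _ ENNReal.ofReal_ne_top]
  rw [← lintegral_indicator measurableSet_Ioi, ← lintegral_indicator measurableSet_Ioo]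
  refine lintegral_congr_ae ?_
  filter_upwards [compl_mem_ae_iff.2 (measure_singleton (1 : ℝ))] with t ht1
  have ht1 : t ≠ 1 := ht1
  by_cases ht : 0 < t
  · rw [Set.indicator_of_mem (Set.mem_Ioi.2 ht)]
    rcases lt_or_gt_of_ne ht1 with h1 | h1
    · have hlog : 0 < -Real.log t := by linarith [Real.log_neg ht h1]
      rw [Set.indicator_of_mem (show t ∈ Set.Ioo (0 : ℝ) 1 from ⟨ht, h1⟩),
        ← ENNReal.ofReal_mul (by positivity)]
      have : {z | t ≤ Real.exp (-s * dist4 w z)} = ball w ((-Real.log t / s) ^ (1 / 4 : ℝ)) :=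
        Set.ext fun z => le_exp_neg_iff hs ht h1 w z
      rw [this, h _ (by positivity), Real.div_rpow hlog.le hs.le, div_pow, div_eq_inv_mul]
    · rw [Set.indicator_of_notMem (fun h => h1.not_gt h.2)]
      have : {z | t ≤ Real.exp (-s * dist4 w z)} = ∅ := by
        ext z
        have : Real.exp (-s * dist4 w z) ≤ 1 := by
          rw [Real.exp_le_one_iff]
          nlinarith [dist4_nonneg w z]
        simpa using this.trans_lt h1
      rw [this, measure_empty]
  · rw [Set.indicator_of_notMem (by simpa using ht),
      Set.indicator_of_notMem (fun h => ht h.1)]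

lemma unitConst_ne_zero (m : ℕ) : unitConst m ≠ 0 := by
  have h : ENNReal.ofReal (Real.exp (-1)) ≤ unitConst m := by
    calc ENNReal.ofReal (Real.exp (-1))
        = ∫⁻ _ in Set.Ioo (0 : ℝ) (Real.exp (-1)), (1 : ℝ≥0∞) := by simp
      _ ≤ ∫⁻ t in Set.Ioo (0 : ℝ) (Real.exp (-1)),
            ENNReal.ofReal (((-Real.log t) ^ (1 / 4 : ℝ)) ^ m) := by
          refine setLIntegral_mono' measurableSet_Ioo fun t ht => ?_
          have : 1 ≤ -Real.log t := by
            have := Real.log_le_log ht.1 ht.2.le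
            rw [Real.log_exp] at this
            linarith
          rw [← ENNReal.ofReal_one]
          exact ENNReal.ofReal_le_ofReal (one_le_pow₀ (Real.one_le_rpow this (by norm_num)))
      _ ≤ unitConst m := lintegral_mono_set (Set.Ioo_subset_Ioo_right (by
          rw [Real.exp_le_one_iff]; norm_num))
  intro h0
  rw [h0, nonpos_iff_eq_zero, ENNReal.ofReal_eq_zero] at h
  exact h.not_gt (Real.exp_pos _)

lemma unitConst_ne_top (m : ℕ) : unitConst m ≠ ∞ := by
  set C : ℝ := m.factorial * 2 ^ m
  have hint : IntegrableOn (fun t : ℝ => 1 + C * t ^ (-(1 / 2) : ℝ)) (Set.Ioo 0 1) := by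
    refine Integrable.add (by simp) (Integrable.const_mul ?_ C)
    have := (intervalIntegral.intervalIntegrable_rpow' (a := 0) (b := 1)
      (r := -(1 / 2)) (by norm_num)).1
    exact this.mono_set Set.Ioo_subset_Ioc_self
  refine ne_top_of_le_ne_top hint.lintegral_lt_top.ne (setLIntegral_mono' measurableSet_Ioo
    fun t ht => ENNReal.ofReal_le_ofReal ?_)
  have hx : 0 < -Real.log t := by linarith [Real.log_neg ht.1 ht.2]
  set x := -Real.log t with hxdef
  have hr : 0 ≤ x ^ (1 / 4 : ℝ) := by positivity
  have h4 : (x ^ (1 / 4 : ℝ)) ^ 4 = x := by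
    rw [← Real.rpow_natCast, ← Real.rpow_mul hx.le]; norm_num
  have h1 : (x ^ (1 / 4 : ℝ)) ^ m ≤ 1 + x ^ m := by
    conv_rhs => rw [← h4, ← pow_mul]
    rcases le_total (x ^ (1 / 4 : ℝ)) 1 with h | h
    · have := pow_le_one₀ (n := m) hr h
      have : 0 ≤ (x ^ (1 / 4 : ℝ)) ^ (4 * m) := by positivity
      linarith
    · have := pow_le_pow_right₀ h (show m ≤ 4 * m by omega)
      linarith
  have h2 : x ^ m ≤ C * t ^ (-(1 / 2) : ℝ) := by
    have h3 := Real.pow_div_factorial_le_exp (x / 2) (by positivity) m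
    rw [div_le_iff₀ (by positivity), div_pow, div_le_iff₀ (by positivity)] at h3
    rw [Real.rpow_def_of_pos ht.1]
    have : Real.log t * -(1 / 2) = x / 2 := by rw [hxdef]; ring
    rw [this]
    linarith
  linarith

lemma gaussConst_ne_zero (m : ℕ) {s : ℝ} (hs : 0 < s) : gaussConst m s ≠ 0 := by
  refine mul_ne_zero ?_ (unitConst_ne_zero m)
  have : 0 < s ^ (1 / 4 : ℝ) := Real.rpow_pos_of_pos hs _
  simpa using by positivity

lemma gaussConst_ne_top (m : ℕ) (s : ℝ) : gaussConst m s ≠ ∞ :=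
  ENNReal.mul_ne_top ENNReal.ofReal_ne_top (unitConst_ne_top m)

lemma integrable_kernel {m : ℕ} {σ : Measure (Heis n)} {w : Heis n} (h : IsUniformAt m σ w)
    {s : ℝ} (hs : 0 < s) : Integrable (fun z => Real.exp (-s * dist4 w z)) σ := by
  have hc : Continuous fun z => Real.exp (-s * dist4 w z) := by fun_prop
  refine ⟨hc.aestronglyMeasurable, ?_⟩
  rw [hasFiniteIntegral_iff_ofReal (ae_of_all _ fun z => (Real.exp_pos _).le),
    lintegral_kernel h hs]
  exact (gaussConst_ne_top m s).lt_top

lemma integral_kernel {m : ℕ} {σ : Measure (Heis n)} {w : Heis n} (h : IsUniformAt m σ w)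
    {s : ℝ} (hs : 0 < s) :
    ∫ z, Real.exp (-s * dist4 w z) ∂σ = (gaussConst m s).toReal := by
  have hc : Continuous fun z => Real.exp (-s * dist4 w z) := by fun_prop
  rw [integral_eq_lintegral_of_nonneg_ae (ae_of_all _ fun z => (Real.exp_pos _).le)
    hc.aestronglyMeasurable, lintegral_kernel h hs]

/-! ### Rescaled measures -/

lemma blowup_eq_map (m : ℕ) (μ : Measure (Heis n)) (r : ℝ) :
    blowup m μ 0 r = ENNReal.ofReal ((r ^ m)⁻¹) • μ.map (dil r⁻¹) := by
  have : (fun y : Heis n => dil r⁻¹ (mul (inv 0) y)) = dil r⁻¹ := by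
    funext y
    congr 1
    ext <;> simp [mul, inv]
  rw [blowup, rescale, this]

lemma blowup_apply (m : ℕ) (μ : Measure (Heis n)) (r : ℝ) {A : Set (Heis n)}
    (hA : MeasurableSet A) :
    blowup m μ 0 r A = ENNReal.ofReal ((r ^ m)⁻¹) * μ (dil r⁻¹ ⁻¹' A) := by
  rw [blowup_eq_map, Measure.smul_apply, Measure.map_apply (continuous_dil _).measurable hA,
    smul_eq_mul]

/-- The dilation by a nonzero factor, as a homeomorphism. -/
def dilHomeo (r : ℝ) (hr : r ≠ 0) : Heis n ≃ₜ Heis n where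
  toFun := dil r
  invFun := dil r⁻¹
  left_inv := fun x => by rw [dil_dil, inv_mul_cancel₀ hr, dil_one]
  right_inv := fun x => by rw [dil_dil, mul_inv_cancel₀ hr, dil_one]
  continuous_toFun := continuous_dil r
  continuous_invFun := continuous_dil r⁻¹

lemma integral_blowup (m : ℕ) (μ : Measure (Heis n)) {r : ℝ} (hr : 0 < r) (f : Heis n → ℝ) :
    ∫ z, f z ∂(blowup m μ 0 r) = (r ^ m)⁻¹ * ∫ z, f (dil r⁻¹ z) ∂μ := by
  rw [blowup_eq_map, integral_smul_measure, ENNReal.toReal_ofReal (by positivity), smul_eq_mul]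
  congr 1
  exact (dilHomeo r⁻¹ (inv_ne_zero hr.ne')).measurableEmbedding.integral_map f

lemma blowup_blowup (m : ℕ) (μ : Measure (Heis n)) (r : ℝ) {t : ℝ} (ht : 0 < t) :
    blowup m (blowup m μ 0 r) 0 t = blowup m μ 0 (r * t) := by
  ext A hA
  have hA' : MeasurableSet (dil t⁻¹ ⁻¹' A) := (continuous_dil _).measurable hA
  rw [blowup_apply _ _ _ hA, blowup_apply _ _ _ hA', blowup_apply _ _ _ hA, ← mul_assoc,
    ← ENNReal.ofReal_mul (by positivity), ← Set.preimage_comp]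
  congr 2
  · rw [mul_pow, mul_inv]; ring
  · congr 1
    funext x
    rw [Function.comp_apply, dil_dil, mul_inv, mul_comm]

lemma regular_blowup (m : ℕ) {μ : Measure (Heis n)} (hμ : IsRadon μ) {r : ℝ} (hr : 0 < r) :
    IsRadon (blowup m μ 0 r) := by
  have : μ.Regular := hμ
  have h : (μ.map (dil r⁻¹)).Regular :=
    Measure.Regular.map (dilHomeo r⁻¹ (inv_ne_zero hr.ne'))
  rw [blowup_eq_map]
  exact Measure.Regular.smul ENNReal.ofReal_ne_top

lemma isUniformAt_blowup {m : ℕ} {μ : Measure (Heis n)} (hμ : IsUniform m μ) {r : ℝ}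
    (hr : 0 < r) {w : Heis n} (hw : dil r w ∈ μ.support) : IsUniformAt m (blowup m μ 0 r) w := by
  intro t ht
  have : dil r⁻¹ ⁻¹' ball w t = ball (dil r w) (r * t) := by
    ext z
    change dist (dil r⁻¹ z) w ≤ t ↔ dist z (dil r w) ≤ r * t
    have hz : dist z (dil r w) = r * dist (dil r⁻¹ z) w := by
      rw [← dist_dil hr.le, dil_dil, mul_inv_cancel₀ hr.ne', dil_one]
    rw [hz, mul_le_mul_iff_right₀ hr]
  rw [blowup_apply _ _ _ (measurableSet_ball w t), this, hμ.measure_ball _ hw _ (by positivity),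
    ← ENNReal.ofReal_mul (by positivity), mul_pow, inv_mul_cancel_left₀ (by positivity)]

lemma isUniformAt_blowup_zero {m : ℕ} {μ : Measure (Heis n)} (hμ : IsUniform m μ) {r : ℝ}
    (hr : 0 < r) : IsUniformAt m (blowup m μ 0 r) 0 :=
  isUniformAt_blowup hμ hr (by simpa using hμ.zero_mem)

/-! ### Limits of rescaled measures -/

/-- `ν` is the limit of the rescaled measures `r^{-m} μ_{0,r}` along the filter `l`. -/
def IsBlowdown (m : ℕ) (μ : Measure (Heis n)) (l : Filter ℝ) (ν : Measure (Heis n)) : Prop :=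
  IsRadon ν ∧ ∀ f : Heis n → ℝ, Continuous f → HasCompactSupport f →
    Tendsto (fun r => ∫ z, f z ∂(blowup m μ 0 r)) l (𝓝 (∫ z, f z ∂ν))

/-- A continuous cutoff function, equal to `1` on the ball of radius `t` around `x` and to `0`
outside the ball of radius `t + η`. -/
def cutoff (x : Heis n) (t η : ℝ) (z : Heis n) : ℝ := max 0 (min 1 ((t + η - dist z x) / η))

lemma continuous_cutoff (x : Heis n) (t η : ℝ) : Continuous (cutoff x t η) := by
  unfold cutoff; fun_prop

lemma cutoff_nonneg (x : Heis n) (t η : ℝ) (z : Heis n) : 0 ≤ cutoff x t η z := le_max_left _ _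

lemma cutoff_le_one (x : Heis n) (t η : ℝ) (z : Heis n) : cutoff x t η z ≤ 1 :=
  max_le zero_le_one (min_le_left _ _)

lemma cutoff_eq_one {x : Heis n} {t η : ℝ} (hη : 0 < η) {z : Heis n} (hz : z ∈ ball x t) :
    cutoff x t η z = 1 := by
  have : 1 ≤ (t + η - dist z x) / η := by
    rw [le_div_iff₀ hη]
    have : dist z x ≤ t := hz
    linarith
  rw [cutoff, min_eq_left this, max_eq_right zero_le_one]

lemma cutoff_eq_zero {x : Heis n} {t η : ℝ} (hη : 0 < η) {z : Heis n} (hz : z ∉ ball x (t + η)) :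
    cutoff x t η z = 0 := by
  have : ¬ dist z x ≤ t + η := hz
  have : (t + η - dist z x) / η ≤ 0 := div_nonpos_of_nonpos_of_nonneg (by linarith) hη.le
  exact max_eq_left ((min_le_right _ _).trans this)

lemma hasCompactSupport_cutoff (x : Heis n) (t : ℝ) {η : ℝ} (hη : 0 < η) :
    HasCompactSupport (cutoff x t η) :=
  HasCompactSupport.intro (isCompact_ball x (t + η)) fun _ hz => cutoff_eq_zero hη hz

lemma measureReal_ball_le_integral_cutoff (σ : Measure (Heis n)) [IsFiniteMeasureOnCompacts σ]
    (x : Heis n) (t : ℝ) {η : ℝ} (hη : 0 < η) : σ.real (ball x t) ≤ ∫ z, cutoff x t η z ∂σ := by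
  rw [← integral_indicator_one (measurableSet_ball x t)]
  refine integral_mono ?_ ((continuous_cutoff x t η).integrable_of_hasCompactSupport
    (hasCompactSupport_cutoff x t hη)) fun z => ?_
  · exact (integrable_indicator_iff (measurableSet_ball x t)).2
      (integrableOn_const (isCompact_ball x t).measure_lt_top.ne)
  · by_cases hz : z ∈ ball x t
    · simp [hz, cutoff_eq_one hη hz]
    · simp [hz, cutoff_nonneg]

lemma integral_cutoff_le_measureReal_ball (σ : Measure (Heis n)) [IsFiniteMeasureOnCompacts σ]
    (x : Heis n) (t : ℝ) {η : ℝ} (hη : 0 < η) :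
    ∫ z, cutoff x t η z ∂σ ≤ σ.real (ball x (t + η)) := by
  rw [← integral_indicator_one (measurableSet_ball x (t + η))]
  refine integral_mono ((continuous_cutoff x t η).integrable_of_hasCompactSupport
    (hasCompactSupport_cutoff x t hη)) ?_ fun z => ?_
  · exact (integrable_indicator_iff (measurableSet_ball x _)).2
      (integrableOn_const (isCompact_ball x _).measure_lt_top.ne)
  · by_cases hz : z ∈ ball x (t + η)
    · simp [hz, cutoff_le_one]
    · simp [hz, cutoff_eq_zero hη hz]

lemma IsUniformAt.measureReal_ball {m : ℕ} {σ : Measure (Heis n)} {w : Heis n}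
    (h : IsUniformAt m σ w) {t : ℝ} (ht : 0 < t) : σ.real (ball w t) = t ^ m := by
  rw [measureReal_def, h t ht, ENNReal.toReal_ofReal (by positivity)]

section

variable {m : ℕ} {μ : Measure (Heis n)} {l : Filter ℝ} {ν : Measure (Heis n)}

/-- A limit of rescalings is `m`-uniform at the limit points of the rescaled supports. -/
lemma IsBlowdown.isUniformAt_of_frequently (hμ : IsUniform m μ) (hl : l ≤ atTop)
    (hν : IsBlowdown m μ l ν) {x : Heis n}
    (hx : ∃ᶠ q in l ×ˢ 𝓝 x, dil q.1 q.2 ∈ μ.support) : IsUniformAt m ν x := by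
  have hνr : ν.Regular := hν.1
  have hconv (t : ℝ) {η : ℝ} (hη : 0 < η) := ((hν.2 _ (continuous_cutoff x t η)
    (hasCompactSupport_cutoff x t hη)).comp (tendsto_fst (f := l) (g := 𝓝 x)))
  have hfreq {η : ℝ} (hη : 0 < η) : ∃ᶠ q in l ×ˢ 𝓝 x,
      (blowup m μ 0 q.1).Regular ∧ IsUniformAt m (blowup m μ 0 q.1) q.2 ∧ dist q.2 x ≤ η := by
    have h1 : ∀ᶠ q : ℝ × Heis n in l ×ˢ 𝓝 x, 0 < q.1 :=
      tendsto_fst.eventually (hl (eventually_gt_atTop 0))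
    have h2 : ∀ᶠ q : ℝ × Heis n in l ×ˢ 𝓝 x, q.2 ∈ ball x η :=
      tendsto_snd.eventually (ball_mem_nhds x hη)
    exact (hx.and_eventually (h1.and h2)).mono fun q ⟨hq, hq1, hq2⟩ =>
      ⟨regular_blowup m hμ.radon hq1, isUniformAt_blowup hμ hq1 hq, hq2⟩
  have hupper {t η : ℝ} (ht : 0 < t) (hη : 0 < η) : ν.real (ball x t) ≤ (t + η + η) ^ m := by
    refine (measureReal_ball_le_integral_cutoff ν x t hη).trans
      (le_of_tendsto_of_frequently (hconv t hη) ((hfreq hη).mono fun q ⟨hr, hu, hd⟩ => ?_))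
    rw [← hu.measureReal_ball (by positivity)]
    refine (integral_cutoff_le_measureReal_ball _ x t hη).trans
      (measureReal_mono ?_ (isCompact_ball _ _).measure_lt_top.ne)
    refine (ball_subset_ball_add (y := q.2) (t + η)).trans fun z (hz : dist z _ ≤ _) => ?_
    rw [dist_comm] at hd
    exact hz.trans (by linarith)
  have hlower {t η : ℝ} (hη : 0 < η) (ht : 2 * η < t) :
      (t - η - η) ^ m ≤ ν.real (ball x t) := by
    have h0 := integral_cutoff_le_measureReal_ball ν x (t - η) hη
    rw [sub_add_cancel] at h0
    refine le_trans (ge_of_tendsto_of_frequently (hconv (t - η) hη)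
      ((hfreq hη).mono fun q ⟨hr, hu, hd⟩ => ?_)) h0
    rw [← hu.measureReal_ball (by linarith)]
    refine le_trans (measureReal_mono ?_ (isCompact_ball _ _).measure_lt_top.ne)
      (measureReal_ball_le_integral_cutoff _ x (t - η) hη)
    refine (ball_subset_ball_add (y := x) (t - η - η)).trans fun z (hz : dist z _ ≤ _) => ?_
    exact hz.trans (by linarith)
  intro t ht
  have hfin : ν (ball x t) ≠ ∞ := (isCompact_ball _ _).measure_lt_top.ne
  rw [← ENNReal.ofReal_toReal hfin, ← measureReal_def]
  congr 1
  apply le_antisymm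
  · have hc : Tendsto (fun η : ℝ => (t + η + η) ^ m) (𝓝[>] 0) (𝓝 (t ^ m)) := by
      have : Continuous fun η : ℝ => (t + η + η) ^ m := by fun_prop
      simpa using (this.tendsto 0).mono_left nhdsWithin_le_nhds
    exact ge_of_tendsto hc (eventually_mem_nhdsWithin.mono fun η hη => hupper ht hη)
  · have hc : Tendsto (fun η : ℝ => (t - η - η) ^ m) (𝓝[>] 0) (𝓝 (t ^ m)) := by
      have : Continuous fun η : ℝ => (t - η - η) ^ m := by fun_prop
      simpa using (this.tendsto 0).mono_left nhdsWithin_le_nhds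
    refine le_of_tendsto hc ?_
    filter_upwards [eventually_mem_nhdsWithin, Ioo_mem_nhdsGT (half_pos ht)] with η hη h2
    exact hlower hη (by linarith [h2.2])

/-- Points of the support of a limit of rescalings are limits of points of rescaled supports. -/
lemma IsBlowdown.frequently_of_mem_support (hl : l ≤ atTop)
    (hν : IsBlowdown m μ l ν) [l.NeBot] {y : Heis n} (hy : y ∈ ν.support) :
    ∃ᶠ q in l ×ˢ 𝓝 y, dil q.1 q.2 ∈ μ.support := by
  have hνr : ν.Regular := hν.1
  intro hne
  obtain ⟨pa, ha, pb, hb, hab⟩ := eventually_prod_iff.1 hne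
  obtain ⟨t, ht, htb⟩ := exists_ball_subset hb
  have hlim := hν.2 _ (continuous_cutoff y (t / 2) (t / 2))
    (hasCompactSupport_cutoff y (t / 2) (half_pos ht))
  have hzero : ∀ᶠ r in l, ∫ z, cutoff y (t / 2) (t / 2) z ∂(blowup m μ 0 r) = 0 := by
    filter_upwards [ha, hl (eventually_gt_atTop 0)] with r hr hr0
    rw [integral_blowup m μ hr0, integral_eq_zero_of_ae, mul_zero]
    filter_upwards [Measure.support_mem_ae (μ := μ)] with z hz
    refine cutoff_eq_zero (half_pos ht) fun hmem => ?_
    rw [add_halves] at hmem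
    refine hab hr (htb hmem) ?_
    change dil r (dil r⁻¹ z) ∈ μ.support
    rwa [dil_dil, mul_inv_cancel₀ hr0.ne', dil_one]
  have h0 : ∫ z, cutoff y (t / 2) (t / 2) z ∂ν = 0 :=
    tendsto_nhds_unique hlim (tendsto_const_nhds.congr' (hzero.mono fun r hr => hr.symm))
  have h1 := measureReal_ball_le_integral_cutoff ν y (t / 2) (half_pos ht)
  rw [h0] at h1
  have h2 : 0 < ν (ball y (t / 2)) :=
    (Measure.mem_support_iff_forall y).1 hy _ (ball_mem_nhds y (half_pos ht))
  exact h1.not_gt (ENNReal.toReal_pos h2.ne' (isCompact_ball _ _).measure_lt_top.ne)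

lemma IsBlowdown.isUniform (hμ : IsUniform m μ) (hl : l ≤ atTop) (hν : IsBlowdown m μ l ν)
    [l.NeBot] : IsUniform m ν := by
  have h0 : IsUniformAt m ν 0 := by
    refine hν.isUniformAt_of_frequently hμ hl ?_
    have : ∃ᶠ r in l, dil r (0 : Heis n) ∈ μ.support :=
      (Eventually.of_forall fun r => by simpa using hμ.zero_mem).frequently
    intro hne
    obtain ⟨pa, ha, pb, hb, hab⟩ := eventually_prod_iff.1 hne
    obtain ⟨r, hr, hr'⟩ := (this.and_eventually ha).exists
    exact hab hr' hb.self_of_nhds hr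
  refine ⟨hν.1, ?_, fun x hx => hν.isUniformAt_of_frequently hμ hl
    (hν.frequently_of_mem_support hl hx)⟩
  rw [Measure.mem_support_iff_forall]
  intro U hU
  obtain ⟨t, ht, htU⟩ := exists_ball_subset hU
  refine lt_of_lt_of_le ?_ (measure_mono htU)
  rw [h0 t ht]
  positivity

lemma IsUniform.isUniformAt (hμ : IsUniform m μ) {x : Heis n} (hx : x ∈ μ.support) :
    IsUniformAt m μ x := hμ.measure_ball x hx

/-- Outside a large ball, the integral of a function with the decay of the kernel is small,
uniformly over the measures which are `m`-uniform at `0`. -/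
lemma abs_integral_sub_integral_cutoff_le {σ : Measure (Heis n)} (h : IsUniformAt m σ 0)
    {g : Heis n → ℝ} (hg : Continuous g) {C a : ℝ} (ha : 0 < a)
    (hC : ∀ z, |g z| ≤ C * Real.exp (-a * dist4 0 z)) {R : ℝ} (hR : 0 < R) :
    |∫ z, g z ∂σ - ∫ z, g z * cutoff 0 R 1 z ∂σ| ≤
      C * (gaussConst m (a / 2)).toReal * Real.exp (-(a / 2) * R ^ 4) := by
  have hgi : Integrable g σ := ((integrable_kernel h ha).const_mul C).mono'
    hg.aestronglyMeasurable (ae_of_all _ hC)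
  have hci : Integrable (fun z => g z * cutoff 0 R 1 z) σ := by
    refine hgi.mono (hg.mul (continuous_cutoff _ _ _)).aestronglyMeasurable
      (ae_of_all _ fun z => ?_)
    rw [norm_mul, Real.norm_of_nonneg (cutoff_nonneg _ _ _ z)]
    exact mul_le_of_le_one_right (norm_nonneg _) (cutoff_le_one _ _ _ z)
  have hC0 : 0 ≤ C := by
    have := (abs_nonneg _).trans (hC 0)
    exact nonneg_of_mul_nonneg_left this (Real.exp_pos _)
  rw [← integral_sub hgi hci, ← integral_kernel h (half_pos ha), mul_right_comm,
    ← integral_const_mul, ← Real.norm_eq_abs]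
  refine norm_integral_le_of_norm_le ((integrable_kernel h (half_pos ha)).const_mul _)
    (ae_of_all _ fun z => ?_)
  rw [Real.norm_eq_abs]
  by_cases hz : z ∈ ball 0 R
  · rw [cutoff_eq_one one_pos hz, mul_one, sub_self, abs_zero]
    positivity
  · have hd : R < dist 0 z := by rw [dist_comm]; exact not_le.1 hz
    have hd4 : R ^ 4 ≤ dist4 0 z := by
      rw [← dist_pow_four]; exact pow_le_pow_left₀ hR.le hd.le 4
    have e1 : |g z - g z * cutoff 0 R 1 z| ≤ |g z| := by
      rw [show g z - g z * cutoff 0 R 1 z = g z * (1 - cutoff 0 R 1 z) by ring, abs_mul]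
      refine mul_le_of_le_one_right (abs_nonneg _) ?_
      rw [abs_of_nonneg (by linarith [cutoff_le_one 0 R 1 z])]
      linarith [cutoff_nonneg 0 R 1 z]
    refine (e1.trans (hC z)).trans ?_
    rw [mul_assoc, ← Real.exp_add]
    refine mul_le_mul_of_nonneg_left (Real.exp_le_exp.2 ?_) hC0
    nlinarith

/-- Convergence of rescalings may be tested on continuous functions with the decay of the
kernel. -/
lemma IsBlowdown.tendsto_integral (hμ : IsUniform m μ) (hl : l ≤ atTop) [l.NeBot]
    (hν : IsBlowdown m μ l ν) {g : Heis n → ℝ} (hg : Continuous g) {C a : ℝ} (ha : 0 < a)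
    (hC : ∀ z, |g z| ≤ C * Real.exp (-a * dist4 0 z)) :
    Tendsto (fun r => ∫ z, g z ∂(blowup m μ 0 r)) l (𝓝 (∫ z, g z ∂ν)) := by
  have hν0 : IsUniformAt m ν 0 :=
    (hν.isUniform hμ hl).isUniformAt (hν.isUniform hμ hl).zero_mem
  rw [Metric.tendsto_nhds]
  intro ε hε
  have htail : Tendsto (fun R : ℝ => C * (gaussConst m (a / 2)).toReal *
      Real.exp (-(a / 2) * R ^ 4)) atTop (𝓝 0) := by
    have h1 : Tendsto (fun R : ℝ => (a / 2) * R ^ 4) atTop atTop :=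
      (tendsto_pow_atTop (by norm_num)).const_mul_atTop (half_pos ha)
    have h2 := (Real.tendsto_exp_neg_atTop_nhds_zero.comp h1).const_mul
      (C * (gaussConst m (a / 2)).toReal)
    simpa [Function.comp_def] using h2
  obtain ⟨R, hRε, hR⟩ := ((htail.eventually (gt_mem_nhds (show 0 < ε / 3 by positivity))).and
    (eventually_gt_atTop 0)).exists
  have hmid := hν.2 (fun z => g z * cutoff 0 R 1 z) (hg.mul (continuous_cutoff _ _ _))
    ((hasCompactSupport_cutoff 0 R one_pos).mul_left)
  filter_upwards [(Metric.tendsto_nhds.1 hmid) (ε / 3) (by positivity),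
    hl (eventually_gt_atTop 0)] with r hr hr0
  have e1 := abs_integral_sub_integral_cutoff_le (isUniformAt_blowup_zero hμ hr0) hg ha hC hR
  have e2 := abs_integral_sub_integral_cutoff_le hν0 hg ha hC hR
  rw [Real.dist_eq] at hr ⊢
  have e1' := e1.trans_lt hRε
  have e2' := e2.trans_lt hRε
  rw [abs_lt] at *
  constructor <;> linarith [e1'.1, e1'.2, e2'.1, e2'.2, hr.1, hr.2]

end

/-! ### The moments of the rescaled measures -/

section

variable {m : ℕ} {μ : Measure (Heis n)} {l l' : Filter ℝ} {ν ν' : Measure (Heis n)}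

lemma abs_kernel_mul_kcoef_le {s : ℝ} {x : Heis n} {C : ℝ}
    (hC : ∀ z, Real.exp (-s * dist4 0 z) * kbound s x z ≤ C * Real.exp (-(s / 2) * dist4 0 z))
    (j : ℕ) (z : Heis n) :
    |Real.exp (-s * dist4 0 z) * kcoef s x z j| ≤ C * Real.exp (-(s / 2) * dist4 0 z) := by
  refine le_trans ?_ (hC z)
  rw [abs_mul, abs_of_pos (Real.exp_pos _)]
  exact mul_le_mul_of_nonneg_left (abs_kcoef_le_kbound s x z j) (Real.exp_pos _).le

lemma integrable_kernel_mul_kcoef {σ : Measure (Heis n)} (h : IsUniformAt m σ 0) {s : ℝ}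
    (hs : 0 < s) (x : Heis n) (j : ℕ) :
    Integrable (fun z => Real.exp (-s * dist4 0 z) * kcoef s x z j) σ := by
  obtain ⟨C, hC⟩ := exists_kbound_le hs x
  refine ((integrable_kernel h (half_pos hs)).const_mul C).mono' ?_
    (ae_of_all _ (abs_kernel_mul_kcoef_le hC j))
  have := continuous_kcoef s x j
  have h2 : Continuous fun z : Heis n => Real.exp (-s * dist4 0 z) := by fun_prop
  exact (h2.mul this).aestronglyMeasurable

lemma integrable_kernel_mul_sum {σ : Measure (Heis n)} (h : IsUniformAt m σ 0) {s : ℝ}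
    (hs : 0 < s) (x : Heis n) (ρ : ℝ) (k : ℕ) :
    Integrable (fun z => Real.exp (-s * dist4 0 z) *
      ∑ j ∈ Finset.range k, ρ ^ (j + 1) * kcoef s x z (j + 1)) σ := by
  have : (fun z => Real.exp (-s * dist4 0 z) *
      ∑ j ∈ Finset.range k, ρ ^ (j + 1) * kcoef s x z (j + 1)) = fun z => ∑ j ∈ Finset.range k,
        ρ ^ (j + 1) * (Real.exp (-s * dist4 0 z) * kcoef s x z (j + 1)) := by
    funext z
    rw [Finset.mul_sum]
    exact Finset.sum_congr rfl fun j _ => by ring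
  rw [this]
  exact integrable_finsetSum _ fun j _ => (integrable_kernel_mul_kcoef h hs x _).const_mul _

/-- For a point `x` of the support of `μ`, the Taylor polynomial at `0`, in the direction of `x`,
of the integral of the kernel against a rescaled measure is small: the integral of the kernel takes
the same value at `0` and at the rescaled point. -/
lemma exists_abs_taylor_le (hμ : IsUniform m μ) {s : ℝ} (hs : 0 < s) {x : Heis n}
    (hx : x ∈ μ.support) (k : ℕ) :
    ∃ C, ∀ r : ℝ, 1 ≤ r → |∫ z, Real.exp (-s * dist4 0 z) *
      ∑ j ∈ Finset.range k, (r⁻¹) ^ (j + 1) * kcoef s x z (j + 1) ∂(blowup m μ 0 r)| ≤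
        (r⁻¹) ^ (k + 1) * C := by
  obtain ⟨C, hC⟩ := exists_kbound_le hs x
  refine ⟨C * (gaussConst m (s / 2)).toReal, fun r hr => ?_⟩
  have hr0 : 0 < r := one_pos.trans_le hr
  have hρ0 : 0 ≤ r⁻¹ := by positivity
  have hρ1 : r⁻¹ ≤ 1 := inv_le_one_of_one_le₀ hr
  have h0 := isUniformAt_blowup_zero hμ hr0
  have hx' : IsUniformAt m (blowup m μ 0 r) (dil r⁻¹ x) := by
    refine isUniformAt_blowup hμ hr0 ?_
    rwa [dil_dil, mul_inv_cancel₀ hr0.ne', dil_one]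
  set σ := blowup m μ 0 r
  set T : Heis n → ℝ := fun z => Real.exp (-s * dist4 0 z) *
      ∑ j ∈ Finset.range k, (r⁻¹) ^ (j + 1) * kcoef s x z (j + 1)
  have hTi : Integrable T σ := integrable_kernel_mul_sum h0 hs x r⁻¹ k
  have hdiff : ∫ z, (Real.exp (-s * dist4 (dil r⁻¹ x) z) - Real.exp (-s * dist4 0 z)) ∂σ = 0 := by
    rw [integral_sub (integrable_kernel hx' hs) (integrable_kernel h0 hs),
      integral_kernel hx' hs, integral_kernel h0 hs, sub_self]
  have hdi : Integrable (fun z => Real.exp (-s * dist4 (dil r⁻¹ x) z) -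
      Real.exp (-s * dist4 0 z)) σ := (integrable_kernel hx' hs).sub (integrable_kernel h0 hs)
  have e : ∫ z, T z ∂σ = -∫ z, ((Real.exp (-s * dist4 (dil r⁻¹ x) z) -
      Real.exp (-s * dist4 0 z)) - T z) ∂σ := by
    rw [integral_sub hdi hTi, hdiff]; ring
  rw [e, abs_neg, ← integral_kernel h0 (half_pos hs), ← integral_const_mul,
    ← integral_const_mul, ← Real.norm_eq_abs]
  refine norm_integral_le_of_norm_le
    (((integrable_kernel h0 (half_pos hs)).const_mul _).const_mul _) (ae_of_all _ fun z => ?_)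
  have h1 := abs_kernel_sub_sum_le s x z hρ0 hρ1 k
  have h2 : (Real.exp (-s * dist4 (dil r⁻¹ x) z) - Real.exp (-s * dist4 0 z)) - T z =
      Real.exp (-s * dist4 0 z) *
        (Real.exp (-s * dist4 (dil r⁻¹ x) z + s * dist4 0 z) - 1 -
          ∑ j ∈ Finset.range k, (r⁻¹) ^ (j + 1) * kcoef s x z (j + 1)) := by
    rw [mul_sub, mul_sub, ← Real.exp_add, mul_one]
    congr 3
    ring
  rw [h2, Real.norm_eq_abs, abs_mul, abs_of_pos (Real.exp_pos _)]
  calc _ ≤ Real.exp (-s * dist4 0 z) * ((r⁻¹) ^ (k + 1) * kbound s x z) :=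
        mul_le_mul_of_nonneg_left h1 (Real.exp_pos _).le
    _ = (r⁻¹) ^ (k + 1) * (Real.exp (-s * dist4 0 z) * kbound s x z) := by ring
    _ ≤ _ := mul_le_mul_of_nonneg_left (hC z) (by positivity)

/-- At a limit point `y` of the rescaled supports, the Taylor coefficients of positive degree of the
integral of the kernel tend to zero along the full family of rescalings. -/
lemma tendsto_integral_kcoef (hμ : IsUniform m μ) {s : ℝ} (hs : 0 < s) (hl : l ≤ atTop)
    {y : Heis n} (hy : ∃ᶠ q in l ×ˢ 𝓝 y, dil q.1 q.2 ∈ μ.support) (k : ℕ) :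
    Tendsto (fun r => ∫ z, Real.exp (-s * dist4 0 z) * kcoef s y z (k + 1) ∂(blowup m μ 0 r))
      atTop (𝓝 0) := by
  obtain ⟨c, hc⟩ := exists_kcoef_eq hl hy k
  choose C hC using fun x : μ.support => exists_abs_taylor_le hμ hs x.2 (k + 1)
  set D := c.sum fun x a => |a| * C x
  have hbound : ∀ r : ℝ, 1 ≤ r →
      |∫ z, Real.exp (-s * dist4 0 z) * kcoef s y z (k + 1) ∂(blowup m μ 0 r)| ≤ r⁻¹ * D := by
    intro r hr
    have hr0 : 0 < r := one_pos.trans_le hr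
    have h0 := isUniformAt_blowup_zero hμ hr0
    set I := fun x : μ.support => ∫ z, Real.exp (-s * dist4 0 z) *
      ∑ j ∈ Finset.range (k + 1), (r⁻¹) ^ (j + 1) * kcoef s (x : Heis n) z (j + 1)
        ∂(blowup m μ 0 r) with hI
    have e : (r⁻¹) ^ (k + 1) *
        ∫ z, Real.exp (-s * dist4 0 z) * kcoef s y z (k + 1) ∂(blowup m μ 0 r) =
          c.sum fun x a => a * I x := by
      rw [← integral_const_mul, Finsupp.sum]
      simp only [hI, ← integral_const_mul]
      rw [← integral_finsetSum _ fun (x : μ.support) _ =>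
        (integrable_kernel_mul_sum h0 hs (x : Heis n) r⁻¹ (k + 1)).const_mul _]
      congr 1
      funext z
      rw [mul_left_comm, hc s r⁻¹ z, Finsupp.sum, Finset.mul_sum]
      exact Finset.sum_congr rfl fun x _ => by ring
    have h1 : (r⁻¹) ^ (k + 1) *
        |∫ z, Real.exp (-s * dist4 0 z) * kcoef s y z (k + 1) ∂(blowup m μ 0 r)| ≤
          (r⁻¹) ^ (k + 1) * (r⁻¹ * D) := by
      calc _ = |c.sum fun x a => a * I x| := by
            rw [← e, abs_mul, abs_of_pos (by positivity : (0:ℝ) < (r⁻¹) ^ (k + 1))]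
        _ ≤ ∑ x ∈ c.support, |c x * I x| := Finset.abs_sum_le_sum_abs _ _
        _ ≤ ∑ x ∈ c.support, (r⁻¹) ^ (k + 1) * (r⁻¹ * (|c x| * C x)) := by
            refine Finset.sum_le_sum fun x _ => ?_
            rw [abs_mul]
            calc |c x| * |I x| ≤ |c x| * ((r⁻¹) ^ (k + 1 + 1) * C x) :=
                  mul_le_mul_of_nonneg_left (hC x r hr) (abs_nonneg _)
              _ = _ := by ring
        _ = _ := by rw [← Finset.mul_sum, ← Finset.mul_sum]; rfl
    exact le_of_mul_le_mul_left h1 (by positivity)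
  refine squeeze_zero_norm' (a := fun r => r⁻¹ * D) ?_ ?_
  · filter_upwards [eventually_ge_atTop 1] with r hr using hbound r hr
  · simpa using tendsto_inv_atTop_zero.mul_const D

/-- Any limit of rescalings has, at the support points of any other limit of rescalings, the same
integrals of the kernel as at its own support points. -/
lemma IsBlowdown.lintegral_kernel_eq [l.NeBot] [l'.NeBot] (hμ : IsUniform m μ) (hl : l ≤ atTop)
    (hl' : l' ≤ atTop) (hν : IsBlowdown m μ l ν) (hν' : IsBlowdown m μ l' ν') {y : Heis n}
    (hy : y ∈ ν'.support) {s : ℝ} (hs : 0 < s) :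
    ∫⁻ z, ENNReal.ofReal (Real.exp (-s * dist4 y z)) ∂ν = gaussConst m s := by
  have hu := hν.isUniform hμ hl
  have h0 : IsUniformAt m ν 0 := hu.isUniformAt hu.zero_mem
  obtain ⟨C, hC⟩ := exists_kbound_le hs y
  have hE : Continuous fun z : Heis n => Real.exp (-s * dist4 0 z) := by fun_prop
  have hmom (k : ℕ) : ∫ z, Real.exp (-s * dist4 0 z) * kcoef s y z (k + 1) ∂ν = 0 := by
    refine tendsto_nhds_unique (hν.tendsto_integral hμ hl (hE.mul (continuous_kcoef s y _))
      (half_pos hs) (abs_kernel_mul_kcoef_le hC _)) ?_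
    exact (tendsto_integral_kcoef hμ hs hl' (hν'.frequently_of_mem_support hl' hy) k).mono_left hl
  have hsum : HasSum (fun j => ∫ z, Real.exp (-s * dist4 0 z) * kcoef s y z j ∂ν)
      (∫ z, Real.exp (-s * dist4 y z) ∂ν) := by
    refine hasSum_integral_of_dominated_convergence
      (fun j z => Real.exp (-s * dist4 0 z) * kabs s y z j)
      (fun j => (hE.mul (continuous_kcoef s y _)).aestronglyMeasurable)
      (fun j => ae_of_all _ fun z => ?_)
      (ae_of_all _ fun z => (hasSum_kabs s y z).summable.mul_left _) ?_
      (ae_of_all _ fun z => ?_)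
    · rw [norm_mul, Real.norm_of_nonneg (Real.exp_pos _).le]
      exact mul_le_mul_of_nonneg_left (abs_kcoef_le s y z j) (Real.exp_pos _).le
    · simp only [tsum_mul_left, (hasSum_kabs s y _).tsum_eq]
      refine ((integrable_kernel h0 (half_pos hs)).const_mul C).mono'
        (hE.mul (continuous_kbound s y)).aestronglyMeasurable (ae_of_all _ fun z => ?_)
      rw [Real.norm_of_nonneg (by unfold kbound; positivity)]
      exact hC z
    · have := (hasSum_kcoef s y z).mul_left (Real.exp (-s * dist4 0 z))
      rwa [← Real.exp_add, show -s * dist4 0 z + (-s * dist4 y z + s * dist4 0 z) =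
        -s * dist4 y z by ring] at this
  have hval : ∫ z, Real.exp (-s * dist4 y z) ∂ν = (gaussConst m s).toReal := by
    rw [← hsum.tsum_eq, tsum_eq_single 0, ← integral_kernel h0 hs]
    · simp [kcoef_zero]
    · intro j hj
      obtain ⟨k, rfl⟩ := Nat.exists_eq_succ_of_ne_zero hj
      exact hmom k
  have hcont : Continuous fun z : Heis n => Real.exp (-s * dist4 y z) := by fun_prop
  -- the kernel is integrable: otherwise its integral, a positive number, would be zero
  have hint : Integrable (fun z : Heis n => Real.exp (-s * dist4 y z)) ν := by
    by_contra hni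
    rw [integral_undef hni] at hval
    exact (ENNReal.toReal_pos (gaussConst_ne_zero m hs) (gaussConst_ne_top m s)).ne hval
  rw [← ofReal_integral_eq_lintegral_ofReal hint (ae_of_all _ fun z => (Real.exp_pos _).le), hval,
    ENNReal.ofReal_toReal (gaussConst_ne_top m s)]

/-! ### Uniqueness of the limit -/

/-- The kernel, divided by its integral, is an approximate identity: its mass outside a
neighbourhood of its centre tends to zero. -/
lemma tendsto_lintegral_kernel_of_mem_nhds {σ : Measure (Heis n)} {y : Heis n}
    (h : ∀ s : ℝ, 0 < s → ∫⁻ z, ENNReal.ofReal (Real.exp (-s * dist4 y z)) ∂σ = gaussConst m s)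
    {U : Set (Heis n)} (hU : MeasurableSet U) (hyU : U ∈ 𝓝 y) :
    Tendsto (fun j : ℕ => (gaussConst m ((j : ℝ) + 1))⁻¹ *
      ∫⁻ z in U, ENNReal.ofReal (Real.exp (-((j : ℝ) + 1) * dist4 y z)) ∂σ) atTop (𝓝 1) := by
  obtain ⟨δ, hδ, hδU⟩ := exists_ball_subset hyU
  have hs (j : ℕ) : (0 : ℝ) < j + 1 := by positivity
  -- on the complement of the ball of radius `δ`, compare with the kernel of parameter `1`
  have htail (j : ℕ) : ∫⁻ z in Uᶜ, ENNReal.ofReal (Real.exp (-((j : ℝ) + 1) * dist4 y z)) ∂σ ≤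
      ENNReal.ofReal (Real.exp (-j * δ ^ 4)) * gaussConst m 1 := by
    rw [← h 1 one_pos, ← lintegral_const_mul' _ _ ENNReal.ofReal_ne_top]
    refine (setLIntegral_mono' hU.compl fun z hz => ?_).trans (setLIntegral_le_lintegral _ _)
    rw [← ENNReal.ofReal_mul (Real.exp_pos _).le, ← Real.exp_add]
    refine ENNReal.ofReal_le_ofReal (Real.exp_le_exp.2 ?_)
    have hd : δ < dist y z := by
      rw [dist_comm]; exact not_le.1 fun hle => hz (hδU hle)
    have hd4 : δ ^ 4 ≤ dist4 y z := by
      rw [← dist_pow_four]; exact pow_le_pow_left₀ hδ.le hd.le 4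
    have : (j : ℝ) * δ ^ 4 ≤ j * dist4 y z := by gcongr
    linarith
  have hg (j : ℕ) : gaussConst m ((j : ℝ) + 1) =
      ENNReal.ofReal (((((j : ℝ) + 1) ^ (1 / 4 : ℝ)) ^ m)⁻¹) * gaussConst m 1 := by
    simp [gaussConst]
  set e : ℕ → ℝ≥0∞ := fun j =>
    ENNReal.ofReal ((((j : ℝ) + 1) ^ (1 / 4 : ℝ)) ^ m * Real.exp (-j * δ ^ 4)) with he
  have he0 : Tendsto e atTop (𝓝 0) := by
    rw [he, ← ENNReal.ofReal_zero]
    refine ENNReal.tendsto_ofReal ?_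
    have hb : Tendsto (fun j : ℕ => ((j : ℝ) + 1) ^ m * Real.exp (-(δ ^ 4) * ((j : ℝ) + 1)) *
        Real.exp (δ ^ 4)) atTop (𝓝 0) := by
      have h1 : Tendsto (fun j : ℕ => (j : ℝ) + 1) atTop atTop :=
        tendsto_atTop_add_const_right _ _ tendsto_natCast_atTop_atTop
      have h2 := ((tendsto_rpow_mul_exp_neg_mul_atTop_nhds_zero m (δ ^ 4) (by positivity)).comp
        h1).mul_const (Real.exp (δ ^ 4))
      simpa [Function.comp_def] using h2
    refine squeeze_zero (fun j => by positivity) (fun j => ?_) hb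
    rw [mul_assoc, ← Real.exp_add, show -(δ ^ 4) * ((j : ℝ) + 1) + δ ^ 4 = -j * δ ^ 4 by ring]
    have : ((j : ℝ) + 1) ^ (1 / 4 : ℝ) ≤ (j : ℝ) + 1 :=
      Real.rpow_le_self_of_one_le (by linarith [Nat.cast_nonneg (α := ℝ) j]) (by norm_num)
    gcongr
  have hle (j : ℕ) : 1 - e j ≤ (gaussConst m ((j : ℝ) + 1))⁻¹ *
      ∫⁻ z in U, ENNReal.ofReal (Real.exp (-((j : ℝ) + 1) * dist4 y z)) ∂σ := by
    set G := gaussConst m ((j : ℝ) + 1) with hG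
    have hG0 : G ≠ 0 := gaussConst_ne_zero m (hs j)
    have hGt : G ≠ ∞ := gaussConst_ne_top m _
    rw [tsub_le_iff_right]
    have hadd := lintegral_add_compl
      (fun z => ENNReal.ofReal (Real.exp (-((j : ℝ) + 1) * dist4 y z))) hU (μ := σ)
    rw [h _ (hs j)] at hadd
    have h2 : ∫⁻ z in Uᶜ, ENNReal.ofReal (Real.exp (-((j : ℝ) + 1) * dist4 y z)) ∂σ ≤
        G * e j := by
      refine (htail j).trans (le_of_eq ?_)
      have hpos : 0 < (((j : ℝ) + 1) ^ (1 / 4 : ℝ)) ^ m := by positivity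
      rw [hG, hg, mul_right_comm, he, ← ENNReal.ofReal_mul (by positivity),
        inv_mul_cancel_left₀ hpos.ne']
    calc (1 : ℝ≥0∞) = G⁻¹ * G := (ENNReal.inv_mul_cancel hG0 hGt).symm
      _ ≤ G⁻¹ * (∫⁻ z in U, ENNReal.ofReal (Real.exp (-((j : ℝ) + 1) * dist4 y z)) ∂σ +
            G * e j) := by
          refine mul_le_mul_right (hadd.symm.trans_le ?_) _
          gcongr
      _ = _ := by rw [mul_add, ← mul_assoc, ENNReal.inv_mul_cancel hG0 hGt, one_mul]
  refine tendsto_of_tendsto_of_tendsto_of_le_of_le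
    (by simpa using ENNReal.Tendsto.sub tendsto_const_nhds he0 (Or.inl ENNReal.one_ne_top))
    tendsto_const_nhds hle fun j => ?_
  calc _ ≤ (gaussConst m ((j : ℝ) + 1))⁻¹ * gaussConst m ((j : ℝ) + 1) := by
        gcongr
        rw [← h _ (hs j)]
        exact setLIntegral_le_lintegral _ _
    _ ≤ 1 := ENNReal.inv_mul_le_one _

/-- Two Radon measures for which the integrals of the kernel centred at support points of the other
one are given by the same constants satisfy an inequality on open sets. -/
lemma measure_le_of_lintegral_kernel_eq (hσ : IsRadon ν) (hσ' : IsRadon ν')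
    (h : ∀ y ∈ ν'.support, ∀ s : ℝ, 0 < s →
      ∫⁻ z, ENNReal.ofReal (Real.exp (-s * dist4 y z)) ∂ν = gaussConst m s)
    (h' : ∀ y ∈ ν.support, ∀ s : ℝ, 0 < s →
      ∫⁻ z, ENNReal.ofReal (Real.exp (-s * dist4 y z)) ∂ν' = gaussConst m s)
    {U : Set (Heis n)} (hU : IsOpen U) : ν' U ≤ ν U := by
  have hr : ν.Regular := hσ
  have hr' : ν'.Regular := hσ'
  let K (j : ℕ) (y z : Heis n) : ℝ≥0∞ :=
    ENNReal.ofReal (Real.exp (-((j : ℝ) + 1) * dist4 y z))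
  have hKm (j : ℕ) : Measurable (Function.uncurry (K j)) := by
    refine ENNReal.measurable_ofReal.comp (Continuous.measurable ?_)
    fun_prop
  let G (j : ℕ) : ℝ≥0∞ := gaussConst m ((j : ℝ) + 1)
  have hs (j : ℕ) : (0 : ℝ) < j + 1 := by positivity
  calc ν' U = ∫⁻ _ in U, 1 ∂ν' := by simp
    _ = ∫⁻ y in U, liminf (fun j => (G j)⁻¹ * ∫⁻ z in U, K j y z ∂ν) atTop ∂ν' := by
        refine setLIntegral_congr_fun_ae hU.measurableSet ?_
        filter_upwards [Measure.support_mem_ae (μ := ν')] with y hy hyU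
        exact (tendsto_lintegral_kernel_of_mem_nhds (h y hy) hU.measurableSet
          (hU.mem_nhds hyU)).liminf_eq.symm
    _ ≤ liminf (fun j => ∫⁻ y in U, (G j)⁻¹ * ∫⁻ z in U, K j y z ∂ν ∂ν') atTop :=
        lintegral_liminf_le fun j => ((hKm j).lintegral_prod_right').const_mul _
    _ ≤ liminf (fun _ : ℕ => ν U) atTop := by
        refine liminf_le_liminf (Eventually.of_forall fun j => ?_)
        have hG0 : G j ≠ 0 := gaussConst_ne_zero m (hs j)
        have hGt : G j ≠ ∞ := gaussConst_ne_top m _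
        rw [lintegral_const_mul' _ _ (ENNReal.inv_ne_top.2 hG0),
          lintegral_lintegral_swap (hKm j).aemeasurable]
        calc (G j)⁻¹ * ∫⁻ z in U, ∫⁻ y in U, K j y z ∂ν' ∂ν
            ≤ (G j)⁻¹ * ∫⁻ _ in U, G j ∂ν := by
              gcongr 1
              refine lintegral_mono_ae (ae_restrict_of_ae ?_)
              filter_upwards [Measure.support_mem_ae (μ := ν)] with z hz
              refine (setLIntegral_le_lintegral _ _).trans (le_of_eq ?_)
              simp only [K, G, ← h' z hz _ (hs j), dist4_comm _ z]
          _ = ν U := by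
              rw [setLIntegral_const, ← mul_assoc, ENNReal.inv_mul_cancel hG0 hGt, one_mul]
    _ = ν U := liminf_const _

/-- All limits of rescalings of a uniform measure coincide. -/
lemma IsBlowdown.unique [l.NeBot] [l'.NeBot] (hμ : IsUniform m μ) (hl : l ≤ atTop)
    (hl' : l' ≤ atTop) (hν : IsBlowdown m μ l ν) (hν' : IsBlowdown m μ l' ν') : ν = ν' := by
  have hr : ν.Regular := hν.1
  have hr' : ν'.Regular := hν'.1
  have h := fun y hy s hs => hν.lintegral_kernel_eq hμ hl hl' hν' (y := y) hy (s := s) hs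
  have h' := fun y hy s hs => hν'.lintegral_kernel_eq hμ hl' hl hν (y := y) hy (s := s) hs
  exact Measure.OuterRegular.ext_isOpen fun U hU => le_antisymm
    (measure_le_of_lintegral_kernel_eq hν'.1 hν.1 h' h hU)
    (measure_le_of_lintegral_kernel_eq hν.1 hν'.1 h h' hU)

/-! ### Existence of the limit -/

/-- Rescalings of a uniform measure converge along every ultrafilter, by the Riesz
representation theorem applied to the limits of the integrals of compactly supported functions. -/
lemma exists_isBlowdown_ultrafilter (hμ : IsUniform m μ) (l : Ultrafilter ℝ)
    (hl : (l : Filter ℝ) ≤ atTop) : ∃ ν, IsBlowdown m μ l ν := by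
  have hlim (f : C_c(Heis n, ℝ)) : ∃ a, Tendsto (fun r => ∫ z, f z ∂(blowup m μ 0 r)) l (𝓝 a) := by
    obtain ⟨R, hR, hK⟩ := exists_subset_ball f.hasCompactSupport
    obtain ⟨B, hB⟩ := f.continuous.bounded_above_of_compact_support f.hasCompactSupport
    have hbd : ∀ᶠ r in (l : Filter ℝ), ∫ z, f z ∂(blowup m μ 0 r) ∈
        Set.Icc (-(B * R ^ m)) (B * R ^ m) := by
      filter_upwards [hl (eventually_gt_atTop 0)] with r hr
      have h0 := isUniformAt_blowup_zero hμ hr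
      rw [Set.mem_Icc, ← abs_le, ← Real.norm_eq_abs,
        ← setIntegral_eq_integral_of_forall_compl_eq_zero (s := ball 0 R)
          fun z hz => image_eq_zero_of_notMem_tsupport fun h => hz (hK h),
        ← h0.measureReal_ball hR]
      exact norm_setIntegral_le_of_norm_le_const (by rw [h0 R hR]; exact ENNReal.ofReal_lt_top)
        fun z _ => hB z
    obtain ⟨a, -, ha⟩ := isCompact_Icc.ultrafilter_le_nhds' (l.map fun r =>
      ∫ z, f z ∂(blowup m μ 0 r)) hbd
    exact ⟨a, ha⟩
  choose Λ hΛ using hlim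
  have hint (r : ℝ) (hr : 0 < r) (f : C_c(Heis n, ℝ)) : Integrable f (blowup m μ 0 r) := by
    have : (blowup m μ 0 r).Regular := regular_blowup m hμ.radon hr
    exact f.continuous.integrable_of_hasCompactSupport f.hasCompactSupport
  let Λ' : C_c(Heis n, ℝ) →ₗ[ℝ] ℝ :=
    { toFun := Λ
      map_add' := fun f g => by
        refine tendsto_nhds_unique (hΛ (f + g)) (((hΛ f).add (hΛ g)).congr' ?_)
        filter_upwards [hl (eventually_gt_atTop 0)] with r hr
        exact (integral_add (hint r hr f) (hint r hr g)).symm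
      map_smul' := fun c f => by
        refine tendsto_nhds_unique (hΛ (c • f)) (((hΛ f).const_mul c).congr fun r => ?_)
        exact (integral_const_mul c _).symm }
  let P : C_c(Heis n, ℝ) →ₚ[ℝ] ℝ := PositiveLinearMap.mk₀ Λ' fun f hf =>
    ge_of_tendsto' (hΛ f) fun r => integral_nonneg hf
  refine ⟨RealRMK.rieszMeasure P, RealRMK.regular_rieszMeasure P, fun f hf hfc => ?_⟩
  have h := RealRMK.integral_rieszMeasure P ⟨⟨f, hf⟩, hfc⟩
  have h2 : ∫ z, f z ∂(RealRMK.rieszMeasure P) = Λ ⟨⟨f, hf⟩, hfc⟩ := h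
  rw [h2]
  exact hΛ ⟨⟨f, hf⟩, hfc⟩

/-- The rescalings of a uniform measure converge. -/
lemma exists_isBlowdown_atTop (hμ : IsUniform m μ) : ∃ ν, IsBlowdown m μ atTop ν := by
  have hl : ((Ultrafilter.of (atTop : Filter ℝ) : Ultrafilter ℝ) : Filter ℝ) ≤ atTop :=
    Ultrafilter.of_le _
  obtain ⟨ν, hν⟩ := exists_isBlowdown_ultrafilter hμ _ hl
  refine ⟨ν, hν.1, fun f hf hfc => ?_⟩
  rw [tendsto_iff_ultrafilter]
  intro g hg
  obtain ⟨ν', hν'⟩ := exists_isBlowdown_ultrafilter hμ g hg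
  rw [hν.unique hμ hl hg hν']
  exact hν'.2 f hf hfc

lemma IsBlowdown.blowup (hν : IsBlowdown m μ l ν) {t : ℝ} (ht : 0 < t) :
    IsBlowdown m μ (l.map fun r => r * t) (blowup m ν 0 t) := by
  refine ⟨regular_blowup m hν.1 ht, fun f hf hfc => ?_⟩
  rw [tendsto_map'_iff]
  have hc : HasCompactSupport fun z => f (dil t⁻¹ z) :=
    hfc.comp_homeomorph (dilHomeo t⁻¹ (inv_ne_zero ht.ne'))
  have h := (hν.2 _ (hf.comp (continuous_dil t⁻¹)) hc).const_mul (t ^ m)⁻¹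
  rw [integral_blowup m ν ht]
  refine h.congr fun r => ?_
  rw [Function.comp_apply, ← blowup_blowup m μ r ht, integral_blowup m _ ht]
  rfl

end

end Heis

end

theorem mainTheorem5 (n : ℕ) (hn : 1 ≤ n) (μ : MeasureTheory.Measure (Heis n))
    (hμ : Heis.IsUniform (2 * n + 1) μ) :
    ∃ ν : MeasureTheory.Measure (Heis n),
      Heis.tanInfty (2 * n + 1) μ = {ν} ∧ Heis.IsUniformCone (2 * n + 1) ν := by
  obtain ⟨ν, hν⟩ := Heis.exists_isBlowdown_atTop hμ
  refine ⟨ν, Set.eq_singleton_iff_unique_mem.2 ⟨?_, ?_⟩, hν.isUniform hμ le_rfl, fun t ht => ?_⟩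
  · have hR : Tendsto (fun i : ℕ => (i : ℝ) + 1) atTop atTop :=
      tendsto_atTop_add_const_right _ _ tendsto_natCast_atTop_atTop
    exact ⟨hν.1, fun i => i + 1, fun i => by positivity, hR,
      fun f hf hfc => (hν.2 f hf hfc).comp hR⟩
  · rintro ν' ⟨hrad, R, -, hR, hconv⟩
    have hν' : Heis.IsBlowdown (2 * n + 1) μ (atTop.map R) ν' :=
      ⟨hrad, fun f hf hfc => tendsto_map'_iff.2 (hconv f hf hfc)⟩
    exact hν'.unique hμ hR le_rfl hν
  · exact (hν.blowup ht).unique hμ (tendsto_id.atTop_mul_const ht) le_rfl hν
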